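/- **Answer Set Prolog.** A ground rule has the form $h_1$ or $\dots$ or $h_k \leftarrow p_1,\dots,p_m,\ not\ n_1,\dots,\ not\ n_s$ with literals $h_i,p_i,n_i$ (atoms or classically negated atoms); $k=0$ is allowed (a denial). For a consistent set $S$ of literals, the reduct of a program relative to $S$ deletes all rules containing $not\ l$ with $l\in S$ and then deletes all $not\ l$ from the remaining rules; $S$ is an answer set if it is inclusion-minimal among the consistent sets satisfying the rules of the reduct. **P-log programs.** A ground P-log program $\Pi$ over a finite sorted signature $\Sigma$ has finitely many attribute terms $a(t)$, each with a finite range, atoms $a(t)=y$ ($y\in range(a)$) and literals $a(t)=y$, $\neg(a(t)=y)$; extended literals are $l$ and $not\ l$. It consists of the declarations; regular rules $l\leftarrow B$ or $\leftarrow B$; random selection rules $[r]\ random(a(t):\{X:p(X)\})\leftarrow K$, where $p$ is a unary Boolean attribute and the set-term may be omitted (then "$p(y)$ holds" below is regarded as true for all $y \in range(a)$); finitely many pr-atoms $pr_r(a(t)=y\,|_c\,B)=v$, $v\in[0,1]$, each indexed by a selection rule $r$ for $a(t)$ of $\Pi$; observations $obs(e)$ ($e$ an extended literal); and actions $do(a(t)=y)$.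 Here $B,K$ are sets of extended literals; $K$ is the premise of $r$. An attribute term is random if $\Pi$ has a selection rule for it. The translation $\tau(\Pi)$ consists of: the facts $c(x)$ for each sort $c$ and $x\in c$; the regular rules; $\neg(a(t)=y_1)\leftarrow a(t)=y_2$ for $y_1\ne y_2$; $intervene(a(t))\leftarrow do(a(t)=y)$; for each selection rule the rule "$a(t)=y_1$ or $\dots$ or $a(t)=y_k\leftarrow K,\ not\ intervene(a(t))$" with $range(a)=\{y_1,\dots,y_k\}$ and, if the set-term is present, $\leftarrow a(t)=y,\ not\ p(y),K,\ not\ intervene(a(t))$ for each $y$; the observations and actions of $\Pi$ as facts; $\leftarrow obs(l),\ not\ l$ and $\leftarrow obs(not\ l),\ l$ for each literal $l$; and $a(t)=y\leftarrow do(a(t)=y)$. The answer sets of $\tau(\Pi)$ are the possible worlds of $\Pi$. **Standing conditions.** $\Pi$ is *admissible* if (1) no possible world satisfies the premises of two different selection rules for the same $a(t)$; (2) for two different pr-atoms $pr_r(a(t)=y\,|_c\,B_1)=v_1$, $pr_r(a(t)=y\,|_c\,B_2)=v_2$ with the same $r$ and $y$, no possible world satisfies $K$, $B_1$ and $B_2$,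 with $K$ the premise of $r$; (3) for each pr-atom $pr_r(a(t)=y\,|_c\,B)=v$, every possible world that satisfies $B$ and the premise of $r$ and does not contain $intervene(a(t))$ contains $p(y)$. **Probability.** The atom $a(t)=y$ is *possible* in $W$ with respect to $\Pi$ if $\Pi$ has a selection rule $r$ for $a(t)$ such that $W$ satisfies its premise and $p(y)$ holds in $W$; then $r$ is a generating rule. $a(t)$ is *active* in $W$ if some $a(t)=y$ is possible in $W$. For a possible world $W$ and an atom $a(t)=y$ possible in $W$, put $P(W,a(t)=y)=v$ if $\Pi$ has a pr-atom $pr_r(a(t)=y\,|_c\,B)=v$ with $r$ the generating rule, $W$ satisfying $B$ and $intervene(a(t))\notin W$ (then the probability is *assigned*); otherwise $P(W,a(t)=y)=(1-\alpha)/\beta$, where $\alpha$ is the sum of the probabilities assigned in $W$ to values of $a(t)$ and $\beta$ is the number of possible values of $a(t)$ in $W$ without assigned probability. Let $\hat\mu_\Pi(W)$ be the product of $P(W,a(t)=y)$ over the atoms $a(t)=y\in W$ that are possible in $W$, and $\mu_\Pi(W)=\hat\mu_\Pi(W)/\sum_{V}\hat\mu_\Pi(V)$ (sum over all possible worlds).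 $P_\Pi$ is *defined* if $\hat\mu_\Pi(W)\neq0$ for some possible world $W$; $P_\Pi(B)$ is the sum of $\mu_\Pi(W)$ over the possible worlds $W$ satisfying all members of $B$. **Coherency.** Let $\Pi'$ be $\Pi$ without its observations and actions. $\Pi$ is *coherent* if it has a possible world, $P_\Pi$ is defined, and for every pr-atom $pr_r(a(t)=y\,|_c\,B)=v$ of $\Pi$ with $K$ the premise of $r$: if $P_{\Pi'}(B\cup K)\ne0$, then $P_{\Pi'\cup obs(B)\cup obs(K)}$ is defined and $P_{\Pi'\cup obs(B)\cup obs(K)}(a(t)=y)=v$. **Causally ordered programs.** A literal occurs in the body of a rule or pr-atom if it occurs, with or without $not$, in its set $B$ (or $K$); all ground instances of $p(X)$ also occur in the body of a selection rule. The heads of a selection rule are all $a(t)=y$, $y\in range(a)$; the head of a pr-atom is its atom $a(t)=y$. The literal $l_1$ is immediately dependent on $l_2$ if, for some regular rule, selection rule or pr-atom of $\Pi$, or some rule $\neg(a(t)=y_1)\leftarrow a(t)=y_2$ ($y_1\neq y_2$), $l_1$ occurs in the head and $l_2$ in the body; "depends on" is the reflexive transitive closure. An attribute term depends on another if some literal formed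 by the first depends on some literal formed by the second. A *strict probabilistic leveling* is a map $|\cdot|$ from attribute terms to $\mathbb N$ such that: distinct random attribute terms have distinct levels; for each selection rule, $|a(t)|$ is greater than the level of every literal in its premise and of every $p(y)$, $y\in range(a)$; for each pr-atom, $|a(t)|$ is greater than the level of every literal in $B$; and if $a_1(t_1)$ is random and $a_2(t_2)$ (random or not) depends on it, then $|a_2(t_2)|\ge|a_1(t_1)|$. (The level of a literal is that of its attribute term.) Let $a_1(t_1),\dots,a_n(t_n)$ be the random attribute terms in increasing order of level. For $1\le i\le n+1$ let $L_i$ be the set of literals that do not depend on any literal formed by $a_j(t_j)$ with $j\ge i$, and let $\Pi_i$ consist of the declarations and of those regular rules, selection rules, observations and actions of $\Pi$ in which only literals of $L_i$ occur. $\Pi$ is *causally ordered* if it has a strict probabilistic leveling such that (1) $\Pi_1$ has exactly one possible world; and for all $1\le i\le n$ and every possible world $W$ of $\Pi_i$: (2) whenever $a_i(t_i)=y_0$ is possible in $W$ with respect to $\Pi_{i+1}$, the program $W\cup\Pi_{i+1}\cup obs(a_i(t_i)=y_0)$ (members of $W$ added as facts) has exactly one possible world; (3) if $a_i(t_i)$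 is not active in $W$ with respect to $\Pi_{i+1}$, then $W\cup\Pi_{i+1}$ has exactly one possible world. **Unitary programs.** Let $r$ be a selection rule of $\Pi$ for $a(t)$ with premise $K$. Two possible worlds of $\Pi$ satisfying $K$ are equivalent if they agree on $p(y)$ for all $y \in range(a)$ and on the satisfaction of the body $B$ of every pr-atom indexed by $r$. A *scenario* $s$ of $r$ is an equivalence class; $range(a(t),r,s)$ is the set of $y\in range(a)$ such that $p(y)$ holds in the worlds of $s$; $at_r(s)$ is the set of pr-atoms indexed by $r$ whose bodies are satisfied in all worlds of $s$. $\Pi$ is *unitary* if for each selection rule $r$ and scenario $s$ of $r$, either every $y\in range(a(t),r,s)$ has a pr-atom for $a(t)=y$ in $at_r(s)$ and the probabilities of the members of $at_r(s)$ sum to $1$, or some $y\in range(a(t),r,s)$ has no pr-atom for $a(t)=y$ in $at_r(s)$ and the probabilities of the members of $at_r(s)$ sum to at most $1$. **Theorem.** Let $\Pi$ be an admissible, causally ordered, unitary P-log program such that the program $\Pi'$ obtained from it by removing all observations and actions is also admissible, causally ordered and unitary. Then $\Pi$ is coherent. In particular, every admissible, causally ordered, unitary P-log program without observations and actions is coherent.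 -/

import Mathlib

/-! ### Answer Set Prolog -/

namespace ASP

/-- Literals over a set of ground atoms: an atom `p` or its classical negation `¬ p`. -/
inductive Literal (α : Type) : Type
  | pos (p : α) : Literal α
  | neg (p : α) : Literal α

namespace Literal

/-- The atom from which a literal is formed. -/
def atom {α : Type} : Literal α → α
  | pos p => p
  | neg p => p

/-- Renaming of atoms. -/
def map {α β : Type} (f : α → β) : Literal α → Literal β
  | pos p => pos (f p)
  | neg p => neg (f p)

instance {α : Type} [Finite α] : Finite (Literal α) := by
  refine Finite.of_injective
    (fun l : Literal α => (match l with
      | pos p => Sum.inl p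
      | neg p => Sum.inr p : α ⊕ α)) ?_
  intro a b h
  cases a <;> cases b <;> simp_all

end Literal

/-- Extended literals: `l` or `not l`, where `not` is default negation. -/
inductive ExtLiteral (α : Type) : Type
  | lit (l : Literal α) : ExtLiteral α
  | naf (l : Literal α) : ExtLiteral α

namespace ExtLiteral

/-- The literal that occurs in an extended literal. -/
def literal {α : Type} : ExtLiteral α → Literal α
  | lit l => l
  | naf l => l

instance {α : Type} [Finite α] : Finite (ExtLiteral α) := by
  refine Finite.of_injective
    (fun l : ExtLiteral α => (match l with
      | lit p => Sum.inl p
      | naf p => Sum.inr p : Literal α ⊕ Literal α)) ?_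
  intro a b h
  cases a <;> cases b <;> simp_all

end ExtLiteral

/-- A ground rule `h₁ or … or hₖ ← p₁, …, pₘ, not n₁, …, not nₛ`. An empty head is a denial. -/
structure Rule (α : Type) : Type where
  head : Set (Literal α)
  pos : Set (Literal α)
  neg : Set (Literal α)

/-- The rule `l.` -/
def fact {α : Type} (l : Literal α) : Rule α where
  head := {l}
  pos := ∅
  neg := ∅

/-- A partial interpretation is a consistent set of literals. -/
def Consistent {α : Type} (S : Set (Literal α)) : Prop :=
  ∀ p : α, ¬ (Literal.pos p ∈ S ∧ Literal.neg p ∈ S)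

/-- `S` satisfies every rule of the program `P`. -/
def Satisfies {α : Type} (S : Set (Literal α)) (P : Set (Rule α)) : Prop :=
  ∀ r ∈ P, r.pos ⊆ S → (∀ l ∈ r.neg, l ∉ S) → ∃ l ∈ r.head, l ∈ S

/-- The reduct of `P` relative to `S`. -/
def reduct {α : Type} (P : Set (Rule α)) (S : Set (Literal α)) : Set (Rule α) :=
  {r | ∃ r₀ ∈ P, (∀ l ∈ r₀.neg, l ∉ S) ∧ r = { head := r₀.head, pos := r₀.pos, neg := ∅ }}

/-- `S` is an answer set of `P`: it is minimal with respect to inclusion among the partial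
interpretations that satisfy the rules of the reduct of `P` relative to `S`. -/
def IsAnswerSet {α : Type} (P : Set (Rule α)) (S : Set (Literal α)) : Prop :=
  Minimal (fun T : Set (Literal α) => Consistent T ∧ Satisfies T (reduct P S)) S

end ASP

/-! ### Syntax of P-log -/

namespace PLog

open ASP

/-- A ground sorted signature together with its declarations: finitely many sorts, ground terms
and attributes; `ext c` is the set of terms of sort `c`, and the attribute `a` is declared as
`a : dom a 0 × ⋯ × dom a (arity a - 1) → rng a`. -/
structure Signature : Type 1 where
  Srt : Type
  Term : Type
  Attr : Type
  finite_srt : Finite Srt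
  finite_term : Finite Term
  finite_attr : Finite Attr
  ext : Srt → Set Term
  arity : Attr → ℕ
  dom : (a : Attr) → Fin (arity a) → Srt
  rng : Attr → Srt
  /-- the sort `{true, false}` -/
  boolean : Srt
  tt : Term
  ff : Term
  tt_ne_ff : tt ≠ ff
  ext_boolean : ext boolean = {tt, ff}

attribute [instance] Signature.finite_srt Signature.finite_term Signature.finite_attr

/-- Ground attribute terms `a(t₁, …, tₙ)`. -/
abbrev AttrTerm (Sg : Signature) : Type :=
  (a : Sg.Attr) × ((i : Fin (Sg.arity a)) → ↥(Sg.ext (Sg.dom a i)))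

/-- The (static) range of an attribute term. -/
abbrev Val (Sg : Signature) (a : AttrTerm Sg) : Type := ↥(Sg.ext (Sg.rng a.1))

/-- Atomic statements `a(t) = y`. -/
abbrev Atom (Sg : Signature) : Type := (a : AttrTerm Sg) × Val Sg a

/-- Literals of the signature. A literal `l` is formed by the attribute term `l.atom.1`. -/
abbrev Lit (Sg : Signature) : Type := Literal (Atom Sg)

/-- Extended literals of the signature. -/
abbrev ExtLit (Sg : Signature) : Type := ExtLiteral (Atom Sg)

/-- Unary Boolean attributes; they occur in set-terms `{X : p(X)}`. -/
structure UnaryRelation (Sg : Signature) : Type where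
  sym : Sg.Attr
  arity_eq : Sg.arity sym = 1
  rng_eq : Sg.rng sym = Sg.boolean

/-- The literal `p(y)`, that is, `p(y) = true`, as a set with one element if `y` is of the sort
required by `p`; otherwise there is no such literal, and the set is empty. -/
def UnaryRelation.inst {Sg : Signature} (p : UnaryRelation Sg) (y : Sg.Term) : Set (Lit Sg) :=
  {l | ∃ x : Atom Sg, l = Literal.pos x ∧ x.1.1 = p.sym ∧
    (∀ i, (x.1.2 i : Sg.Term) = y) ∧ (x.2 : Sg.Term) = Sg.tt}

/-- Rules of the regular part: rules of Answer Set Prolog without disjunction, formed from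
literals of the signature. The head `none` is the empty head. -/
structure RegularRule (Sg : Signature) : Type where
  head : Option (Lit Sg)
  body : Set (ExtLit Sg)

/-- Random selection rules `[r] random(a(t) : {X : p(X)}) ← B`; `range = none` means that the
set-term is omitted, as in `[r] random(a(t)) ← B`. -/
structure SelectionRule (Sg : Signature) : Type where
  attr : AttrTerm Sg
  range : Option (UnaryRelation Sg)
  body : Set (ExtLit Sg)

/-- A pr-atom `pr_r(a(t) = y |_c B) = v`. The index `r` is the random selection rule itself
(instead of a name for it), and `a(t)` is the attribute term of this rule. -/
structure PrAtom (Sg : Signature) : Type where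
  rule : SelectionRule Sg
  val : Val Sg rule.attr
  body : Set (ExtLit Sg)
  prob : ℝ
  prob_mem : prob ∈ Set.Icc (0 : ℝ) 1

/-- The atom `a(t) = y` of a pr-atom. -/
def PrAtom.atom {Sg : Signature} (q : PrAtom Sg) : Atom Sg := ⟨q.rule.attr, q.val⟩

/-- A ground P-log program over a signature. The observation `obs(e)` is allowed for every
extended literal `e`. -/
structure Program (Sg : Signature) : Type where
  regular : Set (RegularRule Sg)
  selection : Set (SelectionRule Sg)
  prAtoms : Finset (PrAtom Sg)
  /-- every pr-atom is indexed by a random selection rule of the program -/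
  prAtoms_rule : ∀ q ∈ prAtoms, q.rule ∈ selection
  obs : Set (ExtLit Sg)
  acts : Set (Atom Sg)

/-- A set of extended literals mentions `l` if `l` or `not l` belongs to it. -/
def Mentions {Sg : Signature} (B : Set (ExtLit Sg)) (l : Lit Sg) : Prop :=
  ∃ e ∈ B, e.literal = l

/-- Literals that occur in the body of a random selection rule: those of `B` and every ground
instance of `p(X)`. -/
def SelectionRule.InBody {Sg : Signature} (r : SelectionRule Sg) (l : Lit Sg) : Prop :=
  Mentions r.body l ∨ ∃ p ∈ r.range, ∃ y : Sg.Term, l ∈ p.inst y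

/-- Literals that occur in the head of a random selection rule: `a(t) = y` for `y` in the range. -/
def SelectionRule.InHead {Sg : Signature} (r : SelectionRule Sg) (l : Lit Sg) : Prop :=
  ∃ y : Val Sg r.attr, l = Literal.pos ⟨r.attr, y⟩

/-! ### Possible worlds -/

/-- Ground atoms of the translation of a P-log program into Answer Set Prolog. -/
inductive TauAtom (Sg : Signature) : Type
  /-- `c(x)`, for a sort `c` -/
  | srt (c : Sg.Srt) (x : Sg.Term) : TauAtom Sg
  /-- `a(t, y)` -/
  | val (x : Atom Sg) : TauAtom Sg
  | obs (e : ExtLit Sg) : TauAtom Sg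
  | act (x : Atom Sg) : TauAtom Sg
  | intervene (a : AttrTerm Sg) : TauAtom Sg

instance {Sg : Signature} : Finite (TauAtom Sg) := by
  refine Finite.of_injective
    (fun l : TauAtom Sg => (match l with
      | .srt c x => Sum.inl (c, x)
      | .val x => Sum.inr (Sum.inl x)
      | .obs e => Sum.inr (Sum.inr (Sum.inl e))
      | .act x => Sum.inr (Sum.inr (Sum.inr (Sum.inl x)))
      | .intervene a => Sum.inr (Sum.inr (Sum.inr (Sum.inr a))) :
      (Sg.Srt × Sg.Term) ⊕ (Atom Sg ⊕ (ExtLit Sg ⊕ (Atom Sg ⊕ AttrTerm Sg))))) ?_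
  intro a b h
  cases a <;> cases b <;> simp_all

/-- Literals of the translation. -/
abbrev TauLit (Sg : Signature) : Type := Literal (TauAtom Sg)

/-- The translation of a literal of the signature. -/
def tauLit {Sg : Signature} (l : Lit Sg) : TauLit Sg := l.map TauAtom.val

/-- Translation of the literals of `B` that are not preceded by `not`. -/
def posPart {Sg : Signature} (B : Set (ExtLit Sg)) : Set (TauLit Sg) :=
  {m | ∃ l, ExtLiteral.lit l ∈ B ∧ m = tauLit l}

/-- Translation of the literals of `B` that are preceded by `not`. -/
def negPart {Sg : Signature} (B : Set (ExtLit Sg)) : Set (TauLit Sg) :=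
  {m | ∃ l, ExtLiteral.naf l ∈ B ∧ m = tauLit l}

/-- The translation of the logical part of a P-log program into Answer Set Prolog. -/
inductive Tau {Sg : Signature} (Q : Program Sg) : Rule (TauAtom Sg) → Prop
  /-- `c(x).` for every term `x` of sort `c` -/
  | srt (c : Sg.Srt) (x : Sg.Term) (hx : x ∈ Sg.ext c) :
      Tau Q (fact (.pos (.srt c x)))
  | regular (ρ : RegularRule Sg) (hρ : ρ ∈ Q.regular) :
      Tau Q { head := {m | ∃ l ∈ ρ.head, m = tauLit l}
              pos := posPart ρ.body
              neg := negPart ρ.body }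
  /-- `¬ a(t, y₁) ← a(t, y₂)` for `y₁ ≠ y₂` -/
  | functional (a : AttrTerm Sg) (y₁ y₂ : Val Sg a) (hy : y₁ ≠ y₂) :
      Tau Q { head := {.neg (.val ⟨a, y₁⟩)}, pos := {.pos (.val ⟨a, y₂⟩)}, neg := ∅ }
  /-- `intervene(a(t)) ← do(a(t, y))` -/
  | intervene (a : AttrTerm Sg) (y : Val Sg a) :
      Tau Q { head := {.pos (.intervene a)}, pos := {.pos (.act ⟨a, y⟩)}, neg := ∅ }
  /-- `a(t, y₁) or … or a(t, yₖ) ← B, not intervene(a(t))` -/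
  | select (r : SelectionRule Sg) (hr : r ∈ Q.selection) :
      Tau Q { head := {m | ∃ y : Val Sg r.attr, m = .pos (.val ⟨r.attr, y⟩)}
              pos := posPart r.body
              neg := negPart r.body ∪ {.pos (.intervene r.attr)} }
  /-- `← a(t, y), not p(y), B, not intervene(a(t))` -/
  | dynamicRange (r : SelectionRule Sg) (hr : r ∈ Q.selection) (p : UnaryRelation Sg)
      (hp : p ∈ r.range) (y : Val Sg r.attr) :
      Tau Q { head := ∅
              pos := posPart r.body ∪ {.pos (.val ⟨r.attr, y⟩)}
              neg := negPart r.body ∪ {.pos (.intervene r.attr)} ∪ tauLit '' p.inst y }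
  | obsFact (e : ExtLit Sg) (he : e ∈ Q.obs) : Tau Q (fact (.pos (.obs e)))
  | actFact (x : Atom Sg) (hx : x ∈ Q.acts) : Tau Q (fact (.pos (.act x)))
  /-- `← obs(l), not l` -/
  | obsLit (l : Lit Sg) :
      Tau Q { head := ∅, pos := {.pos (.obs (.lit l))}, neg := {tauLit l} }
  /-- `← obs(not l), l` -/
  | obsNaf (l : Lit Sg) :
      Tau Q { head := ∅, pos := {.pos (.obs (.naf l)), tauLit l}, neg := ∅ }
  /-- `a(t, y) ← do(a(t, y))` -/
  | act (x : Atom Sg) :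
      Tau Q { head := {.pos (.val x)}, pos := {.pos (.act x)}, neg := ∅ }

/-- The Answer Set Prolog program `τ(Q)`. -/
def tau {Sg : Signature} (Q : Program Sg) : Set (Rule (TauAtom Sg)) := {ρ | Tau Q ρ}

/-- The possible worlds of `Q`: the answer sets of `τ(Q)`. -/
def worlds {Sg : Signature} (Q : Program Sg) : Set (Set (TauLit Sg)) :=
  {W | IsAnswerSet (tau Q) W}

/-- The possible worlds of `V ∪ Q`, where the literals of `V` are added as facts. -/
def worldsWith {Sg : Signature} (V : Set (TauLit Sg)) (Q : Program Sg) : Set (Set (TauLit Sg)) :=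
  {W | IsAnswerSet (tau Q ∪ fact '' V) W}

/-- The program `Q ∪ obs(B)`. -/
def observe {Sg : Signature} (Q : Program Sg) (B : Set (ExtLit Sg)) : Program Sg :=
  { Q with obs := Q.obs ∪ B }

/-- The program obtained from `Q` by removing all observations and actions. -/
def withoutObsActs {Sg : Signature} (Q : Program Sg) : Program Sg :=
  { Q with obs := ∅, acts := ∅ }

/-- An extended literal is true in `W`. -/
def Holds {Sg : Signature} (W : Set (TauLit Sg)) : ExtLit Sg → Prop
  | .lit l => tauLit l ∈ W
  | .naf l => tauLit l ∉ W

/-- `W` satisfies every member of `B`. -/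
def HoldsAll {Sg : Signature} (W : Set (TauLit Sg)) (B : Set (ExtLit Sg)) : Prop :=
  ∀ e ∈ B, Holds W e

/-- `y` is in the dynamic range of the rule `r` in `W`: `p(y) ∈ W` if `r` has a set-term
`{X : p(X)}`, and no condition if the set-term is omitted. -/
def InDynamicRange {Sg : Signature} (W : Set (TauLit Sg)) (r : SelectionRule Sg)
    (y : Sg.Term) : Prop :=
  ∀ p ∈ r.range, ∃ l ∈ p.inst y, tauLit l ∈ W

/-! ### Probability -/

/-- Condition 1, unique selection rule. -/
def UniqueSelection {Sg : Signature} (Q : Program Sg) : Prop :=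
  ∀ r₁ ∈ Q.selection, ∀ r₂ ∈ Q.selection, r₁ ≠ r₂ → r₁.attr = r₂.attr →
    ∀ W ∈ worlds Q, ¬ (HoldsAll W r₁.body ∧ HoldsAll W r₂.body)

/-- Condition 2, unique probability assignment. -/
def UniqueAssignment {Sg : Signature} (Q : Program Sg) : Prop :=
  ∀ q₁ ∈ Q.prAtoms, ∀ q₂ ∈ Q.prAtoms, q₁ ≠ q₂ → q₁.rule = q₂.rule → q₁.atom = q₂.atom →
    ∀ W ∈ worlds Q, ¬ (HoldsAll W q₁.rule.body ∧ HoldsAll W q₁.body ∧ HoldsAll W q₂.body)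

/-- Condition 3, no probabilities assigned outside of the dynamic range. -/
def AssignmentInRange {Sg : Signature} (Q : Program Sg) : Prop :=
  ∀ q ∈ Q.prAtoms, ∀ W ∈ worlds Q, HoldsAll W q.rule.body → HoldsAll W q.body →
    Literal.pos (TauAtom.intervene q.rule.attr) ∉ W → InDynamicRange W q.rule q.val

/-- The three standing conditions on P-log programs. -/
structure Admissible {Sg : Signature} (Q : Program Sg) : Prop where
  uniqueSelection : UniqueSelection Q
  uniqueAssignment : UniqueAssignment Q
  assignmentInRange : AssignmentInRange Q

/-- `r` is a generating rule for the atom `x` in `W` with respect to `Q`. -/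
def Generates {Sg : Signature} (Q : Program Sg) (W : Set (TauLit Sg)) (r : SelectionRule Sg)
    (x : Atom Sg) : Prop :=
  r ∈ Q.selection ∧ r.attr = x.1 ∧ HoldsAll W r.body ∧ InDynamicRange W r x.2

/-- The atom `x` is possible in `W` with respect to `Q`. -/
def Possible {Sg : Signature} (Q : Program Sg) (W : Set (TauLit Sg)) (x : Atom Sg) : Prop :=
  ∃ r, Generates Q W r x

/-- The attribute term `a` is active in `W` with respect to `Q`. -/
def Active {Sg : Signature} (Q : Program Sg) (W : Set (TauLit Sg)) (a : AttrTerm Sg) : Prop :=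
  ∃ y : Val Sg a, Possible Q W ⟨a, y⟩

/-- The pr-atom `q` assigns a probability to the atom `x` in `W`. -/
def Assigns {Sg : Signature} (Q : Program Sg) (W : Set (TauLit Sg)) (q : PrAtom Sg)
    (x : Atom Sg) : Prop :=
  q ∈ Q.prAtoms ∧ q.atom = x ∧ Generates Q W q.rule x ∧ HoldsAll W q.body ∧
    Literal.pos (TauAtom.intervene x.1) ∉ W

/-- `PA(W, x)` is defined. -/
def HasPA {Sg : Signature} (Q : Program Sg) (W : Set (TauLit Sg)) (x : Atom Sg) : Prop :=
  ∃ q, Assigns Q W q x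

open Classical in
/-- The assigned probability `PA(W, x)`. In a possible world of an admissible program there is at
most one pr-atom that assigns a probability to `x`. -/
noncomputable def PA {Sg : Signature} (Q : Program Sg) (W : Set (TauLit Sg)) (x : Atom Sg) : ℝ :=
  if h : HasPA Q W x then h.choose.prob else 0

/-- `α_{a(t)}(W)`, the sum of the assigned probabilities of the values of `a(t)`. -/
noncomputable def alpha {Sg : Signature} (Q : Program Sg) (W : Set (TauLit Sg))
    (a : AttrTerm Sg) : ℝ :=
  ∑ y ∈ (Set.toFinite {y : Val Sg a | HasPA Q W ⟨a, y⟩}).toFinset, PA Q W ⟨a, y⟩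

/-- `β_{a(t)}(W)`, the number of possible values of `a(t)` without an assigned probability. -/
noncomputable def beta {Sg : Signature} (Q : Program Sg) (W : Set (TauLit Sg))
    (a : AttrTerm Sg) : ℕ :=
  {y : Val Sg a | Possible Q W ⟨a, y⟩ ∧ ¬ HasPA Q W ⟨a, y⟩}.ncard

open Classical in
/-- The causal probability `P(W, x)` of an atom `x` that is possible in `W`: the assigned
probability if there is one, and the default probability otherwise. -/
noncomputable def causalProb {Sg : Signature} (Q : Program Sg) (W : Set (TauLit Sg))
    (x : Atom Sg) : ℝ :=
  if HasPA Q W x then PA Q W x else (1 - alpha Q W x.1) / (beta Q W x.1 : ℝ)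

/-- The unnormalized probability of a possible world: the product of `P(W, x)` over the atoms `x`
of `W` for which it is defined. -/
noncomputable def muHat {Sg : Signature} (Q : Program Sg) (W : Set (TauLit Sg)) : ℝ :=
  ∏ x ∈ (Set.toFinite {x : Atom Sg | tauLit (.pos x) ∈ W ∧ Possible Q W x}).toFinset,
    causalProb Q W x

/-- The measure of a possible world. -/
noncomputable def mu {Sg : Signature} (Q : Program Sg) (W : Set (TauLit Sg)) : ℝ :=
  muHat Q W / ∑ V ∈ (Set.toFinite (worlds Q)).toFinset, muHat Q V

/-- `P_Q` is defined: some possible world has nonzero unnormalized probability. -/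
def ProbDefined {Sg : Signature} (Q : Program Sg) : Prop :=
  ∃ W ∈ worlds Q, muHat Q W ≠ 0

/-- The probability, with respect to `Q`, of the conjunction of a set of extended literals. -/
noncomputable def prob {Sg : Signature} (Q : Program Sg) (B : Set (ExtLit Sg)) : ℝ :=
  ∑ W ∈ (Set.toFinite {W | W ∈ worlds Q ∧ HoldsAll W B}).toFinset, mu Q W

/-- Program coherency. -/
structure Coherent {Sg : Signature} (Q : Program Sg) : Prop where
  consistent : (worlds Q).Nonempty
  probDefined : ProbDefined Q
  causal : ∀ q ∈ Q.prAtoms,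
    prob (withoutObsActs Q) (q.body ∪ q.rule.body) ≠ 0 →
    ProbDefined (observe (observe (withoutObsActs Q) q.body) q.rule.body) ∧
    prob (observe (observe (withoutObsActs Q) q.body) q.rule.body) {.lit (.pos q.atom)} = q.prob

/-! ### Causally ordered programs -/

/-- `l₁` is immediately dependent on `l₂`. Besides the regular rules, the random selection rules
and the pr-atoms, the rules `a(t) ≠ y₁ ← a(t) = y₂` that every attribute term carries count. -/
inductive ImmDep {Sg : Signature} (Q : Program Sg) : Lit Sg → Lit Sg → Prop
  | regular (ρ : RegularRule Sg) (hρ : ρ ∈ Q.regular) (l₁ l₂ : Lit Sg) (h₁ : l₁ ∈ ρ.head)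
      (h₂ : Mentions ρ.body l₂) : ImmDep Q l₁ l₂
  | select (r : SelectionRule Sg) (hr : r ∈ Q.selection) (l₁ l₂ : Lit Sg) (h₁ : r.InHead l₁)
      (h₂ : r.InBody l₂) : ImmDep Q l₁ l₂
  | prAtom (q : PrAtom Sg) (hq : q ∈ Q.prAtoms) (l₂ : Lit Sg) (h₂ : Mentions q.body l₂) :
      ImmDep Q (.pos q.atom) l₂
  | functional (a : AttrTerm Sg) (y₁ y₂ : Val Sg a) (hy : y₁ ≠ y₂) :
      ImmDep Q (.neg ⟨a, y₁⟩) (.pos ⟨a, y₂⟩)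

/-- `l₁` depends on `l₂`. -/
def Depends {Sg : Signature} (Q : Program Sg) : Lit Sg → Lit Sg → Prop :=
  Relation.ReflTransGen (ImmDep Q)

/-- The attribute term `a₁` depends on the attribute term `a₂`. -/
def AttrDepends {Sg : Signature} (Q : Program Sg) (a₁ a₂ : AttrTerm Sg) : Prop :=
  ∃ l₁ l₂ : Lit Sg, l₁.atom.1 = a₁ ∧ l₂.atom.1 = a₂ ∧ Depends Q l₁ l₂

/-- The random attribute terms of `Q`. -/
def randomTerms {Sg : Signature} (Q : Program Sg) : Set (AttrTerm Sg) :=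
  {a | ∃ r ∈ Q.selection, r.attr = a}

/-- Strict probabilistic leveling functions. -/
structure StrictLeveling {Sg : Signature} (Q : Program Sg) (lvl : AttrTerm Sg → ℕ) : Prop where
  injective : ∀ a ∈ randomTerms Q, ∀ b ∈ randomTerms Q, lvl a = lvl b → a = b
  selection_body : ∀ r ∈ Q.selection, ∀ l, Mentions r.body l → lvl l.atom.1 < lvl r.attr
  selection_range : ∀ r ∈ Q.selection, ∀ p ∈ r.range, ∀ y : Val Sg r.attr,
    ∀ l ∈ p.inst y, lvl l.atom.1 < lvl r.attr
  prAtom_body : ∀ q ∈ Q.prAtoms, ∀ l, Mentions q.body l → lvl l.atom.1 < lvl q.rule.attr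
  depends : ∀ a₁ ∈ randomTerms Q, ∀ a₂, AttrDepends Q a₂ a₁ → lvl a₁ ≤ lvl a₂

/-- The declarations of `Q` with the regular rules, random selection rules, observations and
actions of `Q` all of whose literals belong to `L`. -/
def restrict {Sg : Signature} (Q : Program Sg) (L : Set (Lit Sg)) : Program Sg where
  regular := {ρ ∈ Q.regular | (∀ l ∈ ρ.head, l ∈ L) ∧ ∀ l, Mentions ρ.body l → l ∈ L}
  selection := {r ∈ Q.selection | (∀ l, r.InHead l → l ∈ L) ∧ ∀ l, r.InBody l → l ∈ L}
  prAtoms := ∅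
  prAtoms_rule := by simp
  obs := {e ∈ Q.obs | e.literal ∈ L}
  acts := {x ∈ Q.acts | Literal.pos x ∈ L}

/-- For an enumeration `a 0, …, a (n - 1)` of the random attribute terms, the literals that do not
depend on literals formed by `a j` for any `j ≥ k`. -/
def language {Sg : Signature} (Q : Program Sg) {n : ℕ} (a : Fin n → AttrTerm Sg) (k : ℕ) :
    Set (Lit Sg) :=
  {l | ∀ j : Fin n, k ≤ (j : ℕ) → ∀ l' : Lit Sg, l'.atom.1 = a j → ¬ Depends Q l l'}

/-- The `k`-th program of the induced structure, for `k = 0, …, n`. -/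
def stage {Sg : Signature} (Q : Program Sg) {n : ℕ} (a : Fin n → AttrTerm Sg) (k : ℕ) :
    Program Sg :=
  restrict Q (language Q a k)

/-- Causally ordered programs. -/
def CausallyOrdered {Sg : Signature} (Q : Program Sg) : Prop :=
  ∃ lvl : AttrTerm Sg → ℕ, StrictLeveling Q lvl ∧
    ∃ (n : ℕ) (a : Fin n → AttrTerm Sg), Set.range a = randomTerms Q ∧
      StrictMono (fun i => lvl (a i)) ∧
      (∃! W, W ∈ worlds (stage Q a 0)) ∧
      ∀ i : Fin n, ∀ W ∈ worlds (stage Q a i),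
        (∀ y : Val Sg (a i), Possible (stage Q a (i + 1)) W ⟨a i, y⟩ →
          ∃! X, X ∈ worldsWith W (observe (stage Q a (i + 1)) {.lit (.pos ⟨a i, y⟩)})) ∧
        (¬ Active (stage Q a (i + 1)) W (a i) →
          ∃! X, X ∈ worldsWith W (stage Q a (i + 1)))

/-! ### Unitary programs -/

/-- Probabilistic equivalence of possible worlds with respect to the rule `r`. -/
def ProbEquiv {Sg : Signature} (Q : Program Sg) (r : SelectionRule Sg)
    (W₁ W₂ : Set (TauLit Sg)) : Prop :=
  (∀ y : Val Sg r.attr, InDynamicRange W₁ r y ↔ InDynamicRange W₂ r y) ∧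
  ∀ q ∈ Q.prAtoms, q.rule = r → (HoldsAll W₁ q.body ↔ HoldsAll W₂ q.body)

/-- The scenarios for `r`: the classes, under probabilistic equivalence, of the possible worlds of
`Q` that satisfy the premise of `r`. -/
def IsScenario {Sg : Signature} (Q : Program Sg) (r : SelectionRule Sg)
    (s : Set (Set (TauLit Sg))) : Prop :=
  ∃ W ∈ worlds Q, HoldsAll W r.body ∧
    s = {W' | W' ∈ worlds Q ∧ HoldsAll W' r.body ∧ ProbEquiv Q r W W'}

/-- `range(a(t), r, s)`, the possible values of `a(t)` in the worlds of the scenario `s`. -/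
def scenarioRange {Sg : Signature} (r : SelectionRule Sg) (s : Set (Set (TauLit Sg))) :
    Set (Val Sg r.attr) :=
  {y | ∃ W ∈ s, InDynamicRange W r y}

open Classical in
/-- `at_r(s)`, the pr-atoms indexing `r` that are active in the scenario `s`. -/
noncomputable def activePrAtoms {Sg : Signature} (Q : Program Sg) (r : SelectionRule Sg)
    (s : Set (Set (TauLit Sg))) : Finset (PrAtom Sg) :=
  {q ∈ Q.prAtoms | q.rule = r ∧ ∀ W ∈ s, HoldsAll W q.body}

/-- The rule `r` is unitary in `Q`. -/
def UnitaryRule {Sg : Signature} (Q : Program Sg) (r : SelectionRule Sg) : Prop :=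
  ∀ s, IsScenario Q r s →
    ((∀ y ∈ scenarioRange r s, ∃ q ∈ activePrAtoms Q r s, q.atom = ⟨r.attr, y⟩) ∧
      ∑ q ∈ activePrAtoms Q r s, q.prob = 1) ∨
    ((∃ y ∈ scenarioRange r s, ¬ ∃ q ∈ activePrAtoms Q r s, q.atom = ⟨r.attr, y⟩) ∧
      ∑ q ∈ activePrAtoms Q r s, q.prob ≤ 1)

/-- Unitary programs. -/
def Unitary {Sg : Signature} (Q : Program Sg) : Prop :=
  ∀ r ∈ Q.selection, UnitaryRule Q r

end PLog

/-! The possible worlds of the stages of a causally ordered program form a tree, and the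
unnormalized measure is a product of transition weights along its branches. Stages are numbered from
0 to `n`, and stage `n` has the worlds of the whole program. The tree comes from a splitting
argument. The language of a stage is closed under dependency, so projecting a world of a later stage
to it gives a world of the earlier stage (`DependencyClosed.project_mem_worlds`), and the worlds of
a later stage with `W` added as facts are exactly its worlds that project to `W`
(`DependencyClosed.mem_worldsWith_iff`). An added observation only filters worlds. Causal ordering
therefore says that a node `W` of stage `k` has exactly one child for each possible value of `a k`,
and exactly one child if `a k` is inactive. The measure of a world is a product of one weight per
random attribute term (`muHat_eq_prod_weight`). By the leveling, the premises, dynamic ranges and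
pr-atom bodies that govern `a k` are expressed in the language of stage `k`; so the weight of `a k`
depends only on the parent node, on the value taken, and on the fixed set of actions. Unitarity
makes the weights of the children of a node sum to 1 (`sum_causalProb_eq_one`,
`CausalOrder.sum_weight_eq_one`). Hence the total measure of a condition is settled as soon as its
literals are available (`CausalOrder.stageSum_eq`). The empty condition has total 1, so some world
has nonzero measure. For a pr-atom on `a k`, the body and the premise belong to the language of
stage `k`. Without actions, each node satisfying them has a single child with the prescribed value,
of weight `v`; so adding the atom multiplies the total measure by `v`
(`CausallyOrdered.totalMeasure_prAtom`). Since observing the body and the premise restricts the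
measure to the worlds where they hold (`totalMeasure_observe`), the conditional probability is `v`.
-/

namespace ASP

/-! ### Answer sets as minimal models of the reduct -/

/-- `T` satisfies the reduct of `P` relative to `S`. -/
def ReductModel {α : Type} (P : Set (Rule α)) (S T : Set (Literal α)) : Prop :=
  ∀ r ∈ P, (∀ l ∈ r.neg, l ∉ S) → r.pos ⊆ T → ∃ l ∈ r.head, l ∈ T

theorem satisfies_reduct_iff {α : Type} {P : Set (Rule α)} {S T : Set (Literal α)} :
    Satisfies T (reduct P S) ↔ ReductModel P S T := by
  constructor
  · intro h r hr hn hp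
    exact h { head := r.head, pos := r.pos, neg := ∅ } ⟨r, hr, hn, rfl⟩ hp (by simp)
  · rintro h _ ⟨r, hr, hn, rfl⟩ hp -
    exact h r hr hn hp

theorem Consistent.mono {α : Type} {S T : Set (Literal α)} (h : Consistent T) (hST : S ⊆ T) :
    Consistent S :=
  fun p hp => h p ⟨hST hp.1, hST hp.2⟩

/-- Subsets of a consistent set are consistent, so minimality can be tested against all reduct
models inside `X`, without regard to consistency. -/
theorem isAnswerSet_iff {α : Type} {P : Set (Rule α)} {X : Set (Literal α)} :
    IsAnswerSet P X ↔ Consistent X ∧ ReductModel P X X ∧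
      ∀ T, T ⊆ X → ReductModel P X T → X ⊆ T := by
  constructor
  · intro h
    exact ⟨h.prop.1, satisfies_reduct_iff.1 h.prop.2, fun T hT hm =>
      h.le_of_le ⟨h.prop.1.mono hT, satisfies_reduct_iff.2 hm⟩ hT⟩
  · rintro ⟨hc, hm, hmin⟩
    exact ⟨⟨hc, satisfies_reduct_iff.2 hm⟩, fun T hT hle =>
      hmin T hle (satisfies_reduct_iff.1 hT.2)⟩

theorem ReductModel.mono {α : Type} {P P' : Set (Rule α)} {S T : Set (Literal α)}
    (h : ReductModel P' S T) (hP : P ⊆ P') : ReductModel P S T :=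
  fun r hr => h r (hP hr)

theorem ReductModel.anti {α : Type} {P : Set (Rule α)} {S S' T : Set (Literal α)}
    (h : ReductModel P S T) (hS : S ⊆ S') : ReductModel P S' T :=
  fun r hr hn => h r hr fun l hl hlS => hn l hl (hS hlS)

theorem ReductModel.mem_of_fact {α : Type} {P : Set (Rule α)} {S T : Set (Literal α)}
    (h : ReductModel P S T) {l : Literal α} (hl : fact l ∈ P) : l ∈ T := by
  obtain ⟨m, hm, hmT⟩ := h (fact l) hl (by simp [fact]) (by simp [fact])
  simp only [fact, Set.mem_singleton_iff] at hm
  exact hm ▸ hmT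

theorem reductModel_union {α : Type} {P P' : Set (Rule α)} {S T : Set (Literal α)} :
    ReductModel (P ∪ P') S T ↔ ReductModel P S T ∧ ReductModel P' S T := by
  constructor
  · exact fun h => ⟨h.mono Set.subset_union_left, h.mono Set.subset_union_right⟩
  · rintro ⟨h, h'⟩ r (hr | hr)
    exacts [h r hr, h' r hr]

theorem reductModel_fact {α : Type} {F S T : Set (Literal α)} :
    ReductModel (fact '' F) S T ↔ F ⊆ T := by
  constructor
  · intro h l hl
    exact h.mem_of_fact ⟨l, hl, rfl⟩
  · rintro h _ ⟨l, hl, rfl⟩ - -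
    exact ⟨l, by simp [fact], h hl⟩

theorem IsAnswerSet.consistent {α : Type} {P : Set (Rule α)} {X : Set (Literal α)}
    (h : IsAnswerSet P X) : Consistent X := h.prop.1

theorem IsAnswerSet.reductModel {α : Type} {P : Set (Rule α)} {X : Set (Literal α)}
    (h : IsAnswerSet P X) : ReductModel P X X := satisfies_reduct_iff.1 h.prop.2

theorem IsAnswerSet.subset_of_model {α : Type} {P : Set (Rule α)} {X T : Set (Literal α)}
    (h : IsAnswerSet P X) (hT : T ⊆ X) (hm : ReductModel P X T) : X ⊆ T :=
  (isAnswerSet_iff.1 h).2.2 T hT hm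

/-- Every literal of an answer set is the head literal of a rule whose body is satisfied. -/
theorem IsAnswerSet.supported {α : Type} {P : Set (Rule α)} {X : Set (Literal α)}
    (h : IsAnswerSet P X) {l : Literal α} (hl : l ∈ X) :
    ∃ r ∈ P, l ∈ r.head ∧ r.pos ⊆ X ∧ ∀ m ∈ r.neg, m ∉ X := by
  by_contra! hno
  -- Removing an unsupported literal leaves a model of the reduct, against minimality.
  have : X ⊆ X \ {l} := by
    refine h.subset_of_model Set.sdiff_subset fun r hr hn hp => ?_
    have hp' := hp.trans Set.sdiff_subset
    obtain ⟨m, hm, hmX⟩ := h.reductModel r hr hn hp'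
    refine ⟨m, hm, hmX, ?_⟩
    rintro rfl
    obtain ⟨k, hk, hkX⟩ := hno r hr hm hp'
    exact hn k hk hkX
  exact (this hl).2 rfl

/-- A larger set has a smaller reduct, so `X` is also a model of the reduct relative to `Y`, and `Y`
is minimal. -/
theorem IsAnswerSet.eq_of_subset {α : Type} {P : Set (Rule α)} {X Y : Set (Literal α)}
    (hX : IsAnswerSet P X) (hY : IsAnswerSet P Y) (h : X ⊆ Y) : X = Y :=
  h.antisymm (hY.subset_of_model h (hX.reductModel.anti h))

theorem IsAnswerSet.union_facts {α : Type} {P : Set (Rule α)} {X F : Set (Literal α)}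
    (h : IsAnswerSet P X) (hF : F ⊆ X) : IsAnswerSet (P ∪ fact '' F) X := by
  refine isAnswerSet_iff.2 ⟨h.consistent, reductModel_union.2
    ⟨h.reductModel, reductModel_fact.2 hF⟩, fun T hT hm => ?_⟩
  exact h.subset_of_model hT (reductModel_union.1 hm).1

end ASP

namespace PLog

open ASP

/-! ### Splitting a program along a set of literals -/

/-- The literals of the translation that are formed from literals of `L`. -/
def tauLanguage {Sg : Signature} (L : Set (Lit Sg)) : Set (TauLit Sg) :=
  {m | match m with
    | .pos (.srt _ _) => True
    | .pos (.val x) => .pos x ∈ L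
    | .neg (.val x) => .neg x ∈ L
    | .pos (.obs e) => e.literal ∈ L
    | .pos (.act x) => .pos x ∈ L
    -- An action on any value derives `intervene`, so all values must be in `L` for the rules
    -- deriving it to stay inside the language.
    | .pos (.intervene a) => ∀ y : Val Sg a, .pos ⟨a, y⟩ ∈ L
    | .neg _ => False}

theorem tauLit_mem_tauLanguage {Sg : Signature} {L : Set (Lit Sg)} {l : Lit Sg} :
    tauLit l ∈ tauLanguage L ↔ l ∈ L := by
  cases l <;> exact Iff.rfl

theorem tauLit_pos {Sg : Signature} (x : Atom Sg) :
    tauLit (Literal.pos x) = Literal.pos (TauAtom.val x) := rfl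

theorem tauLanguage_mono {Sg : Signature} {L L' : Set (Lit Sg)} (h : L ⊆ L') :
    tauLanguage L ⊆ tauLanguage L' := by
  rintro (m | m) hm <;> cases m
  · trivial
  · exact h hm
  · exact h hm
  · exact h hm
  · exact fun y => h (hm y)
  · exact hm
  · exact h hm
  · exact hm
  · exact hm
  · exact hm

/-- The literals derived from `S` by the rules for `intervene` and by the functionality rules. -/
def consequences {Sg : Signature} (S : Set (TauLit Sg)) : Set (TauLit Sg) :=
  {m | (∃ a, ∃ y : Val Sg a, .pos (.act ⟨a, y⟩) ∈ S ∧ m = .pos (.intervene a)) ∨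
    ∃ a, ∃ y₁ y₂ : Val Sg a, y₁ ≠ y₂ ∧ .pos (.val ⟨a, y₂⟩) ∈ S ∧ m = .neg (.val ⟨a, y₁⟩)}

/-- The part of `X` that concerns the literals of `L`. -/
def project {Sg : Signature} (L : Set (Lit Sg)) (X : Set (TauLit Sg)) : Set (TauLit Sg) :=
  -- A restricted program keeps every functionality and `intervene` rule. Their heads may fall
  -- outside the language although their bodies are inside, so a bare intersection need not be a
  -- model.
  (X ∩ tauLanguage L) ∪ consequences (X ∩ tauLanguage L)

theorem consequences_mono {Sg : Signature} {S T : Set (TauLit Sg)} (h : S ⊆ T) :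
    consequences S ⊆ consequences T := by
  rintro m (⟨a, y, hy, rfl⟩ | ⟨a, y₁, y₂, hne, hy, rfl⟩)
  · exact Or.inl ⟨a, y, h hy, rfl⟩
  · exact Or.inr ⟨a, y₁, y₂, hne, h hy, rfl⟩

theorem project_congr {Sg : Signature} {L : Set (Lit Sg)} {X Y : Set (TauLit Sg)}
    (h : X ∩ tauLanguage L = Y ∩ tauLanguage L) : project L X = project L Y := by
  simp only [project, h]

theorem consequences_subset {Sg : Signature} {Q : Program Sg} {S T : Set (TauLit Sg)}
    (h : ReductModel (tau Q) S T) : consequences T ⊆ T := by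
  rintro m (⟨a, y, hy, rfl⟩ | ⟨a, y₁, y₂, hne, hy, rfl⟩)
  · obtain ⟨l, hl, hlT⟩ := h _ (Tau.intervene a y) (by simp) (by simpa using hy)
    simp only [Set.mem_singleton_iff] at hl
    exact hl ▸ hlT
  · obtain ⟨l, hl, hlT⟩ := h _ (Tau.functional a y₁ y₂ hne) (by simp) (by simpa using hy)
    simp only [Set.mem_singleton_iff] at hl
    exact hl ▸ hlT

theorem project_subset {Sg : Signature} {Q : Program Sg} {S T : Set (TauLit Sg)}
    (h : ReductModel (tau Q) S T) (L : Set (Lit Sg)) : project L T ⊆ T :=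
  Set.union_subset Set.inter_subset_left
    ((consequences_mono Set.inter_subset_left).trans (consequences_subset h))

theorem mem_of_mem_project_val {Sg : Signature} {L : Set (Lit Sg)} {X : Set (TauLit Sg)}
    {x : Atom Sg} (h : .pos (.val x) ∈ project L X) :
    .pos (.val x) ∈ X ∧ Literal.pos x ∈ L := by
  rcases h with h | (⟨a, y, hy, h⟩ | ⟨a, y₁, y₂, hne, hy, h⟩)
  · exact h
  · simp at h
  · simp at h

theorem mem_of_mem_project_act {Sg : Signature} {L : Set (Lit Sg)} {X : Set (TauLit Sg)}
    {x : Atom Sg} (h : .pos (.act x) ∈ project L X) :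
    .pos (.act x) ∈ X ∧ Literal.pos x ∈ L := by
  rcases h with h | (⟨a, y, hy, h⟩ | ⟨a, y₁, y₂, hne, hy, h⟩)
  · exact h
  · simp at h
  · simp at h

theorem mem_of_mem_project_obs {Sg : Signature} {L : Set (Lit Sg)} {X : Set (TauLit Sg)}
    {e : ExtLit Sg} (h : .pos (.obs e) ∈ project L X) :
    .pos (.obs e) ∈ X ∧ e.literal ∈ L := by
  rcases h with h | (⟨a, y, hy, h⟩ | ⟨a, y₁, y₂, hne, hy, h⟩)
  · exact h
  · simp at h
  · simp at h

/-- The translation is monotone in the logical part of the program. -/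
theorem tau_mono {Sg : Signature} {Q Q' : Program Sg} (hr : Q.regular ⊆ Q'.regular)
    (hs : Q.selection ⊆ Q'.selection) (ho : Q.obs ⊆ Q'.obs) (ha : Q.acts ⊆ Q'.acts) :
    tau Q ⊆ tau Q' := by
  intro ρ h
  cases h with
  | srt c x hx => exact .srt c x hx
  | regular ρ hρ => exact .regular ρ (hr hρ)
  | functional a y₁ y₂ hy => exact .functional a y₁ y₂ hy
  | intervene a y => exact .intervene a y
  | select r h => exact .select r (hs h)
  | dynamicRange r h p hp y => exact .dynamicRange r (hs h) p hp y
  | obsFact e he => exact .obsFact e (ho he)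
  | actFact x hx => exact .actFact x (ha hx)
  | obsLit l => exact .obsLit l
  | obsNaf l => exact .obsNaf l
  | act x => exact .act x

theorem tau_restrict_mono {Sg : Signature} {Q : Program Sg} {L L' : Set (Lit Sg)} (h : L ⊆ L') :
    tau (restrict Q L) ⊆ tau (restrict Q L') :=
  tau_mono (fun _ hρ => ⟨hρ.1, fun l hl => h (hρ.2.1 l hl), fun l hl => h (hρ.2.2 l hl)⟩)
    (fun _ hr => ⟨hr.1, fun l hl => h (hr.2.1 l hl), fun l hl => h (hr.2.2 l hl)⟩)
    (fun _ he => ⟨he.1, h he.2⟩) (fun _ hx => ⟨hx.1, h hx.2⟩)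

/-- `L` is closed under dependency, and contains all head literals of a random selection rule
as soon as it contains one of them. -/
structure DependencyClosed {Sg : Signature} (Q : Program Sg) (L : Set (Lit Sg)) : Prop where
  immDep : ∀ l ∈ L, ∀ l', ImmDep Q l l' → l' ∈ L
  heads : ∀ r ∈ Q.selection, ∀ y y' : Val Sg r.attr,
    Literal.pos ⟨r.attr, y⟩ ∈ L → Literal.pos ⟨r.attr, y'⟩ ∈ L

theorem posPart_subset {Sg : Signature} {L : Set (Lit Sg)} {B : Set (ExtLit Sg)}
    (h : ∀ l, Mentions B l → l ∈ L) : posPart B ⊆ tauLanguage L := by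
  rintro _ ⟨l, hl, rfl⟩
  exact tauLit_mem_tauLanguage.2 (h l ⟨_, hl, rfl⟩)

theorem negPart_subset {Sg : Signature} {L : Set (Lit Sg)} {B : Set (ExtLit Sg)}
    (h : ∀ l, Mentions B l → l ∈ L) : negPart B ⊆ tauLanguage L := by
  rintro _ ⟨l, hl, rfl⟩
  exact tauLit_mem_tauLanguage.2 (h l ⟨_, hl, rfl⟩)

/-- A rule with a head literal formed from `L` is a rule of the restriction to `L`. -/
theorem DependencyClosed.rule_mem {Sg : Signature} {Q : Program Sg} {L L' : Set (Lit Sg)}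
    (hL : DependencyClosed Q L) {ρ : Rule (TauAtom Sg)} (hρ : ρ ∈ tau (restrict Q L'))
    {m : TauLit Sg} (hm : m ∈ ρ.head) (hmL : m ∈ tauLanguage L) :
    ρ ∈ tau (restrict Q L) ∧ ρ.head ⊆ tauLanguage L ∧ ρ.pos ⊆ tauLanguage L := by
  cases hρ with
  | srt c x hx =>
    refine ⟨.srt c x hx, ?_, by simp [fact]⟩
    rintro _ rfl; trivial
  | regular ρ hρ =>
    obtain ⟨l, hl, rfl⟩ := hm
    have hlL := tauLit_mem_tauLanguage.1 hmL
    have hb : ∀ l', Mentions ρ.body l' → l' ∈ L := fun l' hl' =>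
      hL.immDep l hlL l' (.regular ρ hρ.1 l l' hl hl')
    have hh : ∀ l' ∈ ρ.head, l' ∈ L := by
      intro l' hl'
      rw [Option.mem_def] at hl hl'
      rw [hl] at hl'
      exact Option.some.inj hl' ▸ hlL
    refine ⟨.regular ρ ⟨hρ.1, hh, hb⟩, ?_, posPart_subset hb⟩
    rintro _ ⟨l', hl', rfl⟩
    exact tauLit_mem_tauLanguage.2 (hh l' hl')
  | functional a y₁ y₂ hy =>
    obtain rfl : m = _ := hm
    refine ⟨.functional a y₁ y₂ hy, ?_, ?_⟩
    · rintro _ rfl; exact hmL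
    · rintro _ rfl; exact hL.immDep (.neg ⟨a, y₁⟩) hmL _ (.functional a y₁ y₂ hy)
  | intervene a y =>
    obtain rfl : m = _ := hm
    refine ⟨.intervene a y, ?_, ?_⟩
    · rintro _ rfl; exact hmL
    · rintro _ rfl; exact hmL y
  | select r h =>
    obtain ⟨y, rfl⟩ := hm
    have hy : Literal.pos ⟨r.attr, y⟩ ∈ L := hmL
    have hb : ∀ l', r.InBody l' → l' ∈ L := fun l' hl' =>
      hL.immDep _ hy l' (.select r h.1 _ l' ⟨y, rfl⟩ hl')
    refine ⟨.select r ⟨h.1, ?_, hb⟩, ?_, posPart_subset fun l hl => hb l (Or.inl hl)⟩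
    · rintro _ ⟨y', rfl⟩; exact hL.heads r h.1 y y' hy
    · rintro _ ⟨y', rfl⟩; exact hL.heads r h.1 y y' hy
  | dynamicRange r h p hp y => exact absurd hm (by simp)
  | obsFact e he =>
    obtain rfl : m = _ := hm
    refine ⟨.obsFact e ⟨he.1, hmL⟩, ?_, by simp [fact]⟩
    rintro _ rfl; exact hmL
  | actFact x hx =>
    obtain rfl : m = _ := hm
    refine ⟨.actFact x ⟨hx.1, hmL⟩, ?_, by simp [fact]⟩
    rintro _ rfl; exact hmL
  | obsLit l => exact absurd hm (by simp)
  | obsNaf l => exact absurd hm (by simp)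
  | act x =>
    obtain rfl : m = _ := hm
    refine ⟨.act x, ?_, ?_⟩
    · rintro _ rfl; exact hmL
    · rintro _ rfl; exact hmL

theorem mem_project_of_mem {Sg : Signature} {L : Set (Lit Sg)} {X : Set (TauLit Sg)}
    {m : TauLit Sg} (h : m ∈ X) (hm : m ∈ tauLanguage L) : m ∈ project L X := Or.inl ⟨h, hm⟩

/-- Projection of a model of the reduct. -/
theorem ReductModel.project {Sg : Signature} {Q : Program Sg} {L L' : Set (Lit Sg)}
    (hLL : L ⊆ L') {X S T : Set (TauLit Sg)} (hT : ReductModel (tau (restrict Q L')) X T)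
    (hS : ∀ m ∈ tauLanguage L, m ∈ X → m ∈ S) :
    ReductModel (tau (restrict Q L)) S (project L T) := by
  have hsub := project_subset hT L
  -- A rule whose head and negative body stay in the language transfers directly from `T`. The
  -- functionality and `intervene` rules may violate this and are served by `consequences`.
  have key : ∀ ρ ∈ tau (restrict Q L), ρ.neg ⊆ tauLanguage L → ρ.head ⊆ tauLanguage L →
      (∀ l ∈ ρ.neg, l ∉ S) → ρ.pos ⊆ PLog.project L T → ∃ l ∈ ρ.head, l ∈ PLog.project L T := by
    intro ρ hρ hneg hhead hn hp
    obtain ⟨l, hl, hlT⟩ := hT ρ (tau_restrict_mono hLL hρ)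
      (fun l hl hlX => hn l hl (hS l (hneg hl) hlX)) (hp.trans hsub)
    exact ⟨l, hl, mem_project_of_mem hlT (hhead hl)⟩
  intro ρ hρ
  have hρ' : Tau (restrict Q L) ρ := hρ
  cases hρ' with
  | srt c x hx => exact key _ hρ (by simp [fact]) (by rintro _ rfl; trivial)
  | regular ρ h =>
    refine key _ hρ (negPart_subset h.2.2) ?_
    rintro _ ⟨l, hl, rfl⟩
    exact tauLit_mem_tauLanguage.2 (h.2.1 l hl)
  | functional a y₁ y₂ hy =>
    intro _ hp
    have := mem_of_mem_project_val (hp rfl)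
    exact ⟨_, rfl, Or.inr (Or.inr ⟨a, y₁, y₂, hy, this, rfl⟩)⟩
  | intervene a y =>
    intro _ hp
    have := mem_of_mem_project_act (hp rfl)
    exact ⟨_, rfl, Or.inr (Or.inl ⟨a, y, this, rfl⟩)⟩
  | select r h =>
    have hh : ∀ y : Val Sg r.attr, Literal.pos ⟨r.attr, y⟩ ∈ L := fun y => h.2.1 _ ⟨y, rfl⟩
    refine key _ hρ (Set.union_subset (negPart_subset fun l hl => h.2.2 l (Or.inl hl)) ?_) ?_
    · rintro _ rfl; exact hh
    · rintro _ ⟨y, rfl⟩; exact hh y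
  | dynamicRange r h p hp y =>
    have hh : ∀ y : Val Sg r.attr, Literal.pos ⟨r.attr, y⟩ ∈ L := fun y => h.2.1 _ ⟨y, rfl⟩
    refine key _ hρ (Set.union_subset (Set.union_subset
      (negPart_subset fun l hl => h.2.2 l (Or.inl hl)) ?_) ?_) (by simp)
    · rintro _ rfl; exact hh
    · rintro _ ⟨l, hl, rfl⟩
      exact tauLit_mem_tauLanguage.2 (h.2.2 l (Or.inr ⟨p, hp, y, hl⟩))
  | obsFact e he => exact key _ hρ (by simp [fact]) (by rintro _ rfl; exact he.2)
  | actFact x hx => exact key _ hρ (by simp [fact]) (by rintro _ rfl; exact hx.2)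
  | obsLit l =>
    intro hn hp
    have hl := (mem_of_mem_project_obs (hp rfl)).2
    refine key _ hρ ?_ (by simp) hn hp
    rintro _ rfl
    exact tauLit_mem_tauLanguage.2 hl
  | obsNaf l => exact key _ hρ (by simp) (by simp)
  | act x =>
    intro hn hp
    refine key _ hρ (by simp) ?_ hn hp
    rintro _ rfl
    exact (mem_of_mem_project_act (hp rfl)).2

theorem project_inter {Sg : Signature} {Q : Program Sg} {S X : Set (TauLit Sg)}
    (h : ReductModel (tau Q) S X) (L : Set (Lit Sg)) :
    project L X ∩ tauLanguage L = X ∩ tauLanguage L := by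
  ext m
  exact ⟨fun hm => ⟨project_subset h L hm.1, hm.2⟩, fun hm => ⟨Or.inl hm, hm.2⟩⟩

/-- The projection of a possible world is a possible world of the restricted program. -/
theorem DependencyClosed.project_mem_worlds {Sg : Signature} {Q : Program Sg}
    {L L' : Set (Lit Sg)} (hL : DependencyClosed Q L) (hLL : L ⊆ L') {X : Set (TauLit Sg)}
    (hX : X ∈ worlds (restrict Q L')) : project L X ∈ worlds (restrict Q L) := by
  have hX' : IsAnswerSet _ X := hX
  have hsub := project_subset hX'.reductModel L
  refine isAnswerSet_iff.2 ⟨hX'.consistent.mono hsub,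
    ReductModel.project hLL hX'.reductModel fun m hm hmX => mem_project_of_mem hmX hm,
    fun T hT hm => ?_⟩
  -- Exchange the part of `X` inside the language for that of the smaller model `T`. Rules with a
  -- head literal in the language see only `T`; for the others the head literal supplied by `X`
  -- survives. Minimality of `X` then forces `T` to contain the whole inner part.
  have hmodel : ReductModel (tau (restrict Q L')) X ((T ∩ tauLanguage L) ∪ (X \ tauLanguage L)) := by
    intro ρ hρ hn hp
    have hpX : ρ.pos ⊆ X := fun l hl => (hp hl).elim (fun h => hsub (hT h.1)) fun h => h.1
    obtain ⟨l, hl, hlX⟩ := hX'.reductModel ρ hρ hn hpX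
    by_cases hlU : l ∈ tauLanguage L
    · obtain ⟨hρL, hhead, hpos⟩ := hL.rule_mem hρ hl hlU
      obtain ⟨l', hl', hlT⟩ := hm ρ hρL (fun k hk hkX => hn k hk (hsub hkX))
        fun k hk => (hp hk).elim (fun h => h.1) fun h => absurd (hpos hk) h.2
      exact ⟨l', hl', Or.inl ⟨hlT, hhead hl'⟩⟩
    · exact ⟨l, hl, Or.inr ⟨hlX, hlU⟩⟩
  have hXT := hX'.subset_of_model
    (Set.union_subset (Set.inter_subset_left.trans (hT.trans hsub)) Set.sdiff_subset) hmodel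
  have hU : X ∩ tauLanguage L ⊆ T := fun l hl =>
    (hXT hl.1).elim (fun h => h.1) fun h => absurd hl.2 h.2
  exact Set.union_subset hU ((consequences_mono hU).trans (consequences_subset hm))

/-- The projection of `W` is a world of the same program contained in `W`, and answer sets are
incomparable. -/
theorem DependencyClosed.project_self {Sg : Signature} {Q : Program Sg}
    {L : Set (Lit Sg)} (hL : DependencyClosed Q L) {W : Set (TauLit Sg)}
    (hW : W ∈ worlds (restrict Q L)) : project L W = W :=
  IsAnswerSet.eq_of_subset (hL.project_mem_worlds subset_rfl hW) hW
    (project_subset (IsAnswerSet.reductModel hW) L)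

/-- The possible worlds of `W ∪ Q` are the possible worlds of `Q` that extend `W`. -/
theorem DependencyClosed.mem_worldsWith_iff {Sg : Signature} {Q : Program Sg}
    {L L' : Set (Lit Sg)} (hL : DependencyClosed Q L) (hLL : L ⊆ L') {W X : Set (TauLit Sg)}
    (hW : W ∈ worlds (restrict Q L)) :
    X ∈ worldsWith W (restrict Q L') ↔ X ∈ worlds (restrict Q L') ∧ project L X = W := by
  have hWa : IsAnswerSet _ W := hW
  constructor
  · intro hX
    have hXa : IsAnswerSet _ X := hX
    obtain ⟨hXm, hXf⟩ := reductModel_union.1 hXa.reductModel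
    have hWX : W ⊆ X := reductModel_fact.1 hXf
    -- Literals of the language that are not in `W` can be deleted from `X`: rules with head
    -- literals in the language are already satisfied within `W`. By minimality none were present,
    -- so `X` and `W` agree on the language.
    have hmodel : ReductModel (tau (restrict Q L') ∪ fact '' W) X (X \ (tauLanguage L \ W)) := by
      refine reductModel_union.2 ⟨fun ρ hρ hn hp => ?_,
        reductModel_fact.2 fun l hl => ⟨hWX hl, fun h => h.2 hl⟩⟩
      obtain ⟨l, hl, hlX⟩ := hXm ρ hρ hn (hp.trans Set.sdiff_subset)
      by_cases hlU : l ∈ tauLanguage L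
      · obtain ⟨hρL, hhead, hpos⟩ := hL.rule_mem hρ hl hlU
        obtain ⟨l', hl', hlW⟩ := hWa.reductModel ρ hρL (fun k hk hkX => hn k hk (hWX hkX))
          fun k hk => by_contra fun h => (hp hk).2 ⟨hpos hk, h⟩
        exact ⟨l', hl', hWX hlW, fun h => h.2 hlW⟩
      · exact ⟨l, hl, hlX, fun h => hlU h.1⟩
    have hXW := hXa.subset_of_model Set.sdiff_subset hmodel
    have hU : X ∩ tauLanguage L = W ∩ tauLanguage L := by
      ext l
      exact ⟨fun h => ⟨by_contra fun hl => (hXW h.1).2 ⟨h.2, hl⟩, h.2⟩,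
        fun h => ⟨hWX h.1, h.2⟩⟩
    have hproj : project L X = W := (project_congr hU).trans (hL.project_self hW)
    refine ⟨isAnswerSet_iff.2 ⟨hXa.consistent, hXm, fun T hT hm => ?_⟩, hproj⟩
    have hTW : project L T ⊆ W := by
      rw [← hproj]
      exact Set.union_subset_union (Set.inter_subset_inter_left _ hT)
        (consequences_mono (Set.inter_subset_inter_left _ hT))
    -- Minimality of `W` shows that every reduct model of the larger program inside `X` already
    -- contains `W`, so the added facts do not affect minimality of `X`.
    have hWT : W ⊆ project L T := hWa.subset_of_model hTW
      (ReductModel.project hLL hm fun l hl hlX => (hU.subset ⟨hlX, hl⟩).1)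
    exact hXa.subset_of_model hT (reductModel_union.2
      ⟨hm, reductModel_fact.2 (hWT.trans (project_subset hm L))⟩)
  · rintro ⟨hX, rfl⟩
    exact IsAnswerSet.union_facts hX (project_subset (IsAnswerSet.reductModel hX) L)

/-! ### Observations -/

/-- The facts that record the observations `B`. -/
def obsFacts {Sg : Signature} (B : Set (ExtLit Sg)) : Set (TauLit Sg) :=
  (fun e => .pos (.obs e)) '' B

theorem tau_subset_observe {Sg : Signature} (Q : Program Sg) (B : Set (ExtLit Sg)) :
    tau Q ⊆ tau (observe Q B) :=
  tau_mono subset_rfl subset_rfl Set.subset_union_left subset_rfl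

theorem tau_observe_cases {Sg : Signature} {Q : Program Sg} {B : Set (ExtLit Sg)}
    {ρ : Rule (TauAtom Sg)} (hρ : ρ ∈ tau (observe Q B)) :
    ρ ∈ tau Q ∨ ∃ e ∈ B, ρ = fact (.pos (.obs e)) := by
  cases hρ with
  | obsFact e he => exact he.elim (fun h => Or.inl (.obsFact e h)) fun h => Or.inr ⟨e, h, rfl⟩
  | srt c x h => exact Or.inl (.srt c x h)
  | regular ρ h => exact Or.inl (.regular ρ h)
  | functional a y₁ y₂ h => exact Or.inl (.functional a y₁ y₂ h)
  | intervene a y => exact Or.inl (.intervene a y)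
  | select r h => exact Or.inl (.select r h)
  | dynamicRange r h p hp y => exact Or.inl (Tau.dynamicRange (Q := Q) r h p hp y)
  | actFact x h => exact Or.inl (.actFact x h)
  | obsLit l => exact Or.inl (.obsLit l)
  | obsNaf l => exact Or.inl (.obsNaf l)
  | act x => exact Or.inl (.act x)

/-- The observation literals of an answer set are given by facts. -/
theorem obs_of_mem {Sg : Signature} {Q : Program Sg} {F X : Set (TauLit Sg)}
    (hX : IsAnswerSet (tau Q ∪ fact '' F) X) {e : ExtLit Sg} (he : .pos (.obs e) ∈ X) :
    e ∈ Q.obs ∨ .pos (.obs e) ∈ F := by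
  obtain ⟨ρ, hρ | ⟨l, hl, rfl⟩, hh, -, -⟩ := hX.supported he
  · left
    cases hρ with
    | regular ρ h =>
      obtain ⟨l, -, hl⟩ := hh
      cases l <;> simp [tauLit, Literal.map] at hl
    | obsFact e' he' => simp_all [fact]
    | _ => simp [fact] at hh
  · simp only [fact, Set.mem_singleton_iff] at hh
    exact Or.inr (hh ▸ hl)

/-- Negated observation literals do not occur in answer sets. -/
theorem neg_obs_notMem {Sg : Signature} {Q : Program Sg} {F X : Set (TauLit Sg)}
    (hX : IsAnswerSet (tau Q ∪ fact '' F) X) (hF : ∀ e, .neg (.obs e) ∉ F) (e : ExtLit Sg) :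
    .neg (.obs e) ∉ X := by
  intro he
  obtain ⟨ρ, hρ | ⟨l, hl, rfl⟩, hh, -, -⟩ := hX.supported he
  · cases hρ with
    | regular ρ h =>
      obtain ⟨l, -, hl⟩ := hh
      cases l <;> simp [tauLit, Literal.map] at hl
    | _ => simp [fact] at hh
  · simp only [fact, Set.mem_singleton_iff] at hh
    exact hF e (hh ▸ hl)

theorem tauLit_ne_obs {Sg : Signature} (l : Lit Sg) (e : ExtLit Sg) :
    tauLit l ≠ .pos (.obs e) := by
  cases l <;> simp [tauLit, Literal.map]

/-- Default negation is applied to no observation literal. -/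
theorem obs_notMem_neg {Sg : Signature} {Q : Program Sg} {F : Set (TauLit Sg)}
    {ρ : Rule (TauAtom Sg)} (hρ : ρ ∈ tau Q ∪ fact '' F) (e : ExtLit Sg) :
    .pos (.obs e) ∉ ρ.neg := by
  rcases hρ with hρ | ⟨l, hl, rfl⟩
  · have hneg : ∀ B : Set (ExtLit Sg), .pos (.obs e) ∉ negPart B := by
      rintro B ⟨l, -, hl⟩
      exact tauLit_ne_obs l e hl.symm
    cases hρ with
    | regular ρ h => exact hneg _
    | select r h => simpa using hneg _
    | dynamicRange r h p hp y =>
      simp only [Set.mem_union, not_or]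
      refine ⟨⟨hneg _, by simp⟩, ?_⟩
      rintro ⟨l, -, hl⟩
      exact tauLit_ne_obs l e hl
    | obsLit l => exact fun h => tauLit_ne_obs l e h.symm
    | _ => simp [fact]
  · simp [fact]

/-- Observation literals occur in bodies only as `← obs(l), not l` and `← obs(not l), l`. -/
theorem obs_mem_pos {Sg : Signature} {Q : Program Sg} {F : Set (TauLit Sg)}
    {ρ : Rule (TauAtom Sg)} (hρ : ρ ∈ tau Q ∪ fact '' F) {e : ExtLit Sg}
    (he : .pos (.obs e) ∈ ρ.pos) :
    (∃ l, e = .lit l ∧ ρ.neg = {tauLit l}) ∨ ∃ l, e = .naf l ∧ tauLit l ∈ ρ.pos := by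
  rcases hρ with hρ | ⟨l, hl, rfl⟩
  · have hpos : ∀ B : Set (ExtLit Sg), .pos (.obs e) ∉ posPart B := by
      rintro B ⟨l, -, hl⟩
      exact tauLit_ne_obs l e hl.symm
    cases hρ with
    | regular ρ h => exact absurd he (hpos _)
    | select r h => exact absurd he (hpos _)
    | dynamicRange r h p hp y =>
      rcases he with he | he
      · exact absurd he (hpos _)
      · simp at he
    | obsLit l =>
      left
      simp only [Set.mem_singleton_iff, Literal.pos.injEq, TauAtom.obs.injEq] at he
      exact ⟨l, he, rfl⟩
    | obsNaf l =>
      right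
      rcases he with he | he
      · simp only [Literal.pos.injEq, TauAtom.obs.injEq] at he
        exact ⟨l, he, by simp⟩
      · exact absurd he.symm (tauLit_ne_obs l e)
    | _ => simp [fact] at he
  · simp [fact] at he

theorem holds_union_obsFacts {Sg : Signature} {X : Set (TauLit Sg)} {B : Set (ExtLit Sg)}
    (l : Lit Sg) : tauLit l ∈ X ∪ obsFacts B ↔ tauLit l ∈ X := by
  constructor
  · rintro (h | ⟨e, -, he⟩)
    · exact h
    · exact absurd he.symm (tauLit_ne_obs l e)
  · exact Or.inl

/-- Adding observations that hold in a possible world. -/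
theorem isAnswerSet_observe {Sg : Signature} {Q : Program Sg} {F X : Set (TauLit Sg)}
    {B : Set (ExtLit Sg)} (hX : IsAnswerSet (tau Q ∪ fact '' F) X)
    (hF : ∀ e, .neg (.obs e) ∉ F) (hB : HoldsAll X B) :
    IsAnswerSet (tau (observe Q B) ∪ fact '' F) (X ∪ obsFacts B) := by
  have hXm := hX.reductModel
  refine isAnswerSet_iff.2 ⟨?_, ?_, ?_⟩
  · rintro p ⟨hp | ⟨e, he, hp⟩, hn | ⟨e', he', hn⟩⟩
    · exact hX.consistent p ⟨hp, hn⟩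
    · simp at hn
    · obtain rfl : _ = p := Literal.pos.inj hp
      exact neg_obs_notMem hX hF e hn
    · simp at hn
  · intro ρ hρ hn hp
    by_cases hobs : ∃ e ∈ B, .pos (.obs e) ∈ ρ.pos
    · obtain ⟨e, he, heρ⟩ := hobs
      obtain ⟨l, rfl, hl⟩ | ⟨l, rfl, hl⟩ := obs_mem_pos hρ heρ
      · exact absurd ((holds_union_obsFacts l).2 (hB _ he)) (hn _ (by rw [hl]; rfl))
      · exact absurd ((holds_union_obsFacts l).1 (hp hl)) (hB _ he)
    · have hpX : ρ.pos ⊆ X := by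
        intro l hl
        rcases hp hl with h | ⟨e, he, rfl⟩
        · exact h
        · exact absurd ⟨e, he, hl⟩ hobs
      rcases hρ with hρ | hρ
      · rcases tau_observe_cases hρ with hρ | ⟨e, he, rfl⟩
        · obtain ⟨l, hl, hlX⟩ := hXm ρ (Or.inl hρ) (fun l hl h => hn l hl (Or.inl h)) hpX
          exact ⟨l, hl, Or.inl hlX⟩
        · exact ⟨_, rfl, Or.inr ⟨e, he, rfl⟩⟩
      · obtain ⟨l, hl, hlX⟩ := hXm ρ (Or.inr hρ) (fun l hl h => hn l hl (Or.inl h)) hpX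
        exact ⟨l, hl, Or.inl hlX⟩
  · intro T hT hm
    have hO : obsFacts B ⊆ T := by
      rintro _ ⟨e, he, rfl⟩
      exact hm.mem_of_fact (Or.inl (Tau.obsFact e (Or.inr he)))
    have hXT : X ⊆ T ∩ X := by
      refine hX.subset_of_model Set.inter_subset_right fun ρ hρ hn hp => ?_
      have hρ' : ρ ∈ tau (observe Q B) ∪ fact '' F :=
        hρ.imp (fun h => tau_subset_observe Q B h) id
      by_cases hhead : ∃ e, .pos (.obs e) ∈ ρ.head
      · obtain ⟨l, hl, hlX⟩ := hXm ρ hρ hn (hp.trans Set.inter_subset_right)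
        -- The head literal found in `T` could a priori come only from the new observation facts. A
        -- rule with an observation in its head has a one-element head, so it is the literal known
        -- to be in `X`.
        have hsing : ρ.head = {l} := by
          obtain ⟨e, he⟩ := hhead
          rcases hρ with hρ | ⟨m, hm, rfl⟩
          · cases hρ with
            | regular ρ h =>
              obtain ⟨k, -, hk⟩ := he
              exact absurd hk.symm (tauLit_ne_obs k e)
            | obsFact e' he' =>
              obtain rfl : l = _ := hl
              rfl
            | _ => simp [fact] at he
          · obtain rfl : l = _ := hl
            rfl
        obtain ⟨m, hm, hmT⟩ := hm ρ hρ' (fun k hk hkX => by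
          rcases hkX with h | ⟨e, he, rfl⟩
          · exact hn k hk h
          · exact obs_notMem_neg hρ e hk) (hp.trans Set.inter_subset_left)
        rw [hsing] at hm
        obtain rfl : m = l := hm
        exact ⟨m, hl, hmT, hlX⟩
      · obtain ⟨m, hm, hmT⟩ := hm ρ hρ' (fun k hk hkX => by
          rcases hkX with h | ⟨e, he, rfl⟩
          · exact hn k hk h
          · exact obs_notMem_neg hρ e hk) (hp.trans Set.inter_subset_left)
        refine ⟨m, hm, hmT, ?_⟩
        rcases hT hmT with h | ⟨e, he, rfl⟩
        · exact h
        · exact absurd ⟨e, hm⟩ hhead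
    exact Set.union_subset (hXT.trans Set.inter_subset_left) hO

/-- Every possible world of a program with added observations arises from a possible world of
the program in which they hold. -/
theorem exists_of_isAnswerSet_observe {Sg : Signature} {Q : Program Sg} {F Y : Set (TauLit Sg)}
    {B : Set (ExtLit Sg)} (hY : IsAnswerSet (tau (observe Q B) ∪ fact '' F) Y) :
    ∃ X, IsAnswerSet (tau Q ∪ fact '' F) X ∧ HoldsAll X B ∧ Y = X ∪ obsFacts B := by
  have hYm := hY.reductModel
  have hO : obsFacts B ⊆ Y := by
    rintro _ ⟨e, he, rfl⟩
    exact hYm.mem_of_fact (Or.inl (Tau.obsFact e (Or.inr he)))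
  have hBY : HoldsAll Y B := by
    intro e he
    have heY : .pos (.obs e) ∈ Y := hO ⟨e, he, rfl⟩
    cases e with
    | lit l =>
      by_contra hl
      obtain ⟨m, hm, -⟩ := hYm _ (Or.inl (Tau.obsLit l)) (by rintro _ rfl; exact hl)
        (by rintro _ rfl; exact heY)
      exact hm
    | naf l =>
      intro hl
      obtain ⟨m, hm, -⟩ := hYm _ (Or.inl (Tau.obsNaf l)) (by simp)
        (by rintro _ (rfl | rfl); exacts [heY, hl])
      exact hm
  -- Only observations present solely because of `B` may be removed; those already recorded by `Q`
  -- or `F` remain derivable and must stay.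
  set Z : Set (TauLit Sg) := {m | ∃ e ∈ B, e ∉ Q.obs ∧ .pos (.obs e) ∉ F ∧ m = .pos (.obs e)}
    with hZ
  have hZO : Z ⊆ obsFacts B := by
    rintro _ ⟨e, he, -, -, rfl⟩
    exact ⟨e, he, rfl⟩
  have hYU : Y = (Y \ Z) ∪ obsFacts B := by
    ext m
    by_cases hm : m ∈ Z
    · simp [hm, hO (hZO hm), hZO hm]
    · simp only [Set.mem_union, Set.mem_sdiff, hm, not_false_eq_true, and_true]
      exact ⟨Or.inl, fun h => h.elim id fun h => hO h⟩
  have hneg : ∀ ρ ∈ tau Q ∪ fact '' F, (∀ l ∈ ρ.neg, l ∉ Y \ Z) → ∀ l ∈ ρ.neg, l ∉ Y := by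
    intro ρ hρ hn l hl hlY
    refine hn l hl ⟨hlY, ?_⟩
    rintro ⟨e, -, -, -, rfl⟩
    exact obs_notMem_neg hρ e hl
  have hsub : tau Q ∪ fact '' F ⊆ tau (observe Q B) ∪ fact '' F :=
    Set.union_subset_union_left _ (tau_subset_observe Q B)
  refine ⟨Y \ Z, isAnswerSet_iff.2 ⟨hY.consistent.mono Set.sdiff_subset, ?_, ?_⟩, ?_, hYU⟩
  · intro ρ hρ hn hp
    obtain ⟨l, hl, hlY⟩ := hYm ρ (hsub hρ) (hneg ρ hρ hn) (hp.trans Set.sdiff_subset)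
    refine ⟨l, hl, hlY, ?_⟩
    rintro ⟨e, he, heQ, heF, rfl⟩
    rcases hρ with hρ | ⟨m, hm, rfl⟩
    · cases hρ with
      | regular ρ h =>
        obtain ⟨k, -, hk⟩ := hl
        exact absurd hk.symm (tauLit_ne_obs k e)
      | obsFact e' he' =>
        simp only [fact, Set.mem_singleton_iff, Literal.pos.injEq, TauAtom.obs.injEq] at hl
        exact heQ (hl ▸ he')
      | _ => simp [fact] at hl
    · simp only [fact, Set.mem_singleton_iff] at hl
      exact heF (hl ▸ hm)
  · intro T hT hm
    have hTO : Y ⊆ T ∪ obsFacts B := by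
      refine hY.subset_of_model (Set.union_subset (hT.trans Set.sdiff_subset) hO)
        fun ρ hρ hn hp => ?_
      by_cases hobs : ∃ e ∈ B, .pos (.obs e) ∈ ρ.pos
      · obtain ⟨e, he, heρ⟩ := hobs
        obtain ⟨l, rfl, hl⟩ | ⟨l, rfl, hl⟩ := obs_mem_pos hρ heρ
        · exact absurd (hBY _ he) (hn _ (by rw [hl]; rfl))
        · exact absurd (hT ((holds_union_obsFacts l).1 (hp hl))).1 (hBY _ he)
      · have hpT : ρ.pos ⊆ T := by
          intro l hl
          rcases hp hl with h | ⟨e, he, rfl⟩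
          · exact h
          · exact absurd ⟨e, he, hl⟩ hobs
        have hcase : ρ ∈ tau Q ∪ fact '' F ∨ ∃ e ∈ B, ρ = fact (.pos (.obs e)) := by
          rcases hρ with hρ | hρ
          · exact (tau_observe_cases hρ).imp Or.inl id
          · exact Or.inl (Or.inr hρ)
        rcases hcase with hρQ | ⟨e, he, rfl⟩
        · obtain ⟨l, hl, hlT⟩ := hm ρ hρQ (fun l hl h => hn l hl h.1) hpT
          exact ⟨l, hl, Or.inl hlT⟩
        · exact ⟨_, rfl, Or.inr ⟨e, he, rfl⟩⟩
    intro m hmY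
    rcases hTO hmY.1 with h | ⟨e, he, rfl⟩
    · exact h
    · have : e ∈ Q.obs ∨ .pos (.obs e) ∈ F := by
        by_contra! hne
        exact hmY.2 ⟨e, he, hne.1, hne.2, rfl⟩
      have hfact : fact (.pos (.obs e)) ∈ tau Q ∪ fact '' F :=
        this.imp (fun h => .obsFact e h) fun h => ⟨_, h, rfl⟩
      exact hm.mem_of_fact hfact
  · intro e he
    have := hBY e he
    cases e with
    | lit l =>
      refine ⟨this, ?_⟩
      rintro ⟨e', -, -, -, h⟩
      exact tauLit_ne_obs l e' h
    | naf l => exact fun h => this h.1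

/-- Possible worlds are determined by their union with the added observations. -/
theorem union_obsFacts_injective {Sg : Signature} {Q : Program Sg} {F X Y : Set (TauLit Sg)}
    {B : Set (ExtLit Sg)} (hX : IsAnswerSet (tau Q ∪ fact '' F) X)
    (hY : IsAnswerSet (tau Q ∪ fact '' F) Y) (h : X ∪ obsFacts B = Y ∪ obsFacts B) : X = Y := by
  have key : ∀ {X Y : Set (TauLit Sg)}, IsAnswerSet (tau Q ∪ fact '' F) X →
      IsAnswerSet (tau Q ∪ fact '' F) Y → X ∪ obsFacts B = Y ∪ obsFacts B → X ⊆ Y := by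
    intro X Y hX hY h l hl
    rcases h.subset (Or.inl hl) with hlY | ⟨e, he, rfl⟩
    · exact hlY
    -- An observation literal in `X` comes from a fact of the common program, so it also lies in
    -- `Y`.
    · have hfact : fact (.pos (.obs e)) ∈ tau Q ∪ fact '' F :=
        (obs_of_mem hX hl).imp (fun h => .obsFact e h) fun h => ⟨_, h, rfl⟩
      exact hY.reductModel.mem_of_fact hfact
  exact (key hX hY h).antisymm (key hY hX h.symm)

/-! ### Facts about possible worlds -/

theorem act_mem_iff {Sg : Signature} {Q : Program Sg} {X : Set (TauLit Sg)} (hX : X ∈ worlds Q)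
    (x : Atom Sg) : .pos (.act x) ∈ X ↔ x ∈ Q.acts := by
  have hX' : IsAnswerSet _ X := hX
  constructor
  · intro hx
    obtain ⟨ρ, hρ, hh, -, -⟩ := hX'.supported hx
    cases hρ with
    | regular ρ h =>
      obtain ⟨l, -, hl⟩ := hh
      cases l <;> simp [tauLit, Literal.map] at hl
    | actFact x' hx' => simp_all [fact]
    | _ => simp [fact] at hh
  · exact fun hx => hX'.reductModel.mem_of_fact (.actFact x hx)

theorem intervene_mem_iff {Sg : Signature} {Q : Program Sg} {X : Set (TauLit Sg)}
    (hX : X ∈ worlds Q) (a : AttrTerm Sg) :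
    .pos (.intervene a) ∈ X ↔ ∃ y : Val Sg a, (⟨a, y⟩ : Atom Sg) ∈ Q.acts := by
  have hX' : IsAnswerSet _ X := hX
  constructor
  · intro hx
    obtain ⟨ρ, hρ, hh, hp, -⟩ := hX'.supported hx
    cases hρ with
    | regular ρ h =>
      obtain ⟨l, -, hl⟩ := hh
      cases l <;> simp [tauLit, Literal.map] at hl
    | intervene b y =>
      simp only [Set.mem_singleton_iff, Literal.pos.injEq, TauAtom.intervene.injEq] at hh
      subst hh
      exact ⟨y, (act_mem_iff hX _).1 (hp rfl)⟩
    | _ => simp [fact] at hh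
  · rintro ⟨y, hy⟩
    obtain ⟨l, hl, hlX⟩ := hX'.reductModel _ (Tau.intervene a y) (by simp)
      (by rintro _ rfl; exact (act_mem_iff hX _).2 hy)
    obtain rfl : l = _ := hl
    exact hlX

theorem val_mem_of_act {Sg : Signature} {Q : Program Sg} {X : Set (TauLit Sg)}
    (hX : X ∈ worlds Q) {x : Atom Sg} (hx : x ∈ Q.acts) : .pos (.val x) ∈ X := by
  obtain ⟨l, hl, hlX⟩ := IsAnswerSet.reductModel hX _ (Tau.act x) (by simp)
    (by rintro _ rfl; exact (act_mem_iff hX _).2 hx)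
  obtain rfl : l = _ := hl
  exact hlX

theorem val_unique {Sg : Signature} {Q : Program Sg} {X : Set (TauLit Sg)}
    (hX : X ∈ worlds Q) {a : AttrTerm Sg} {y y' : Val Sg a} (hy : .pos (.val ⟨a, y⟩) ∈ X)
    (hy' : .pos (.val ⟨a, y'⟩) ∈ X) : y = y' := by
  by_contra hne
  obtain ⟨l, hl, hlX⟩ := IsAnswerSet.reductModel hX _ (Tau.functional a y y' hne) (by simp)
    (by rintro _ rfl; exact hy')
  obtain rfl : l = _ := hl
  exact IsAnswerSet.consistent hX _ ⟨hy, hlX⟩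

/-- If the premise of a random selection rule for `a` is satisfied and there is no intervention,
then `a` takes a value from the dynamic range of the rule. -/
theorem exists_val_of_selection {Sg : Signature} {Q : Program Sg} {X : Set (TauLit Sg)}
    (hX : X ∈ worlds Q) {r : SelectionRule Sg} (hr : r ∈ Q.selection) (hb : HoldsAll X r.body)
    (hi : .pos (.intervene r.attr) ∉ X) :
    ∃ y : Val Sg r.attr, .pos (.val ⟨r.attr, y⟩) ∈ X ∧ InDynamicRange X r y := by
  have hpos : posPart r.body ⊆ X := by
    rintro _ ⟨l, hl, rfl⟩; exact hb _ hl
  have hneg : ∀ l ∈ negPart r.body, l ∉ X := by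
    rintro _ ⟨l, hl, rfl⟩; exact hb _ hl
  obtain ⟨l, ⟨y, rfl⟩, hy⟩ := IsAnswerSet.reductModel hX _ (Tau.select r hr)
    (by rintro l (hl | rfl); exacts [hneg l hl, hi]) hpos
  refine ⟨y, hy, fun p hp => ?_⟩
  by_contra! hno
  obtain ⟨l, hl, -⟩ := IsAnswerSet.reductModel hX _ (Tau.dynamicRange r hr p hp y)
    (by rintro l ((hl | rfl) | ⟨m, hm, rfl⟩); exacts [hneg l hl, hi, hno m hm])
    (Set.union_subset hpos (by rintro _ rfl; exact hy))
  exact hl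

/-! ### Causal probabilities -/

/-- The factor that the attribute term `b` contributes to the measure of `X`. -/
noncomputable def weight {Sg : Signature} (Q : Program Sg) (X : Set (TauLit Sg))
    (b : AttrTerm Sg) : ℝ :=
  ∏ y ∈ (Set.toFinite {y : Val Sg b | .pos (.val ⟨b, y⟩) ∈ X ∧ Possible Q X ⟨b, y⟩}).toFinset,
    causalProb Q X ⟨b, y⟩

theorem Possible.random {Sg : Signature} {Q : Program Sg} {X : Set (TauLit Sg)} {x : Atom Sg}
    (h : Possible Q X x) : x.1 ∈ randomTerms Q := by
  obtain ⟨r, hr, hrx, -⟩ := h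
  exact ⟨r, hr, hrx⟩

theorem weight_eq_one {Sg : Signature} {Q : Program Sg} {X : Set (TauLit Sg)}
    {b : AttrTerm Sg} (h : ∀ y : Val Sg b, ¬ Possible Q X ⟨b, y⟩) : weight Q X b = 1 := by
  refine Finset.prod_eq_one fun y hy => ?_
  simp only [Set.Finite.mem_toFinset, Set.mem_ofPred_eq] at hy
  exact absurd hy.2 (h y)

theorem muHat_eq_prod_weight {Sg : Signature} (Q : Program Sg) (X : Set (TauLit Sg)) {n : ℕ}
    {a : Fin n → AttrTerm Sg} (ha : Function.Injective a) (hr : Set.range a = randomTerms Q) :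
    muHat Q X = ∏ i, weight Q X (a i) := by
  classical
  have := Fintype.ofFinite (AttrTerm Sg)
  have h1 : ∏ i, weight Q X (a i) = ∏ b, weight Q X b := by
    refine Fintype.prod_of_injective a ha _ _ (fun b hb => weight_eq_one fun y hy => hb ?_)
      fun i => rfl
    exact hr ▸ hy.random
  rw [h1]
  simp only [weight]
  rw [Finset.prod_sigma']
  refine Finset.prod_congr ?_ fun x _ => rfl
  ext ⟨b, y⟩
  simp [tauLit_pos]

/-- Two sets of literals agree on what determines the causal probabilities of the values
of `b`. -/
structure SameCauses {Sg : Signature} (Q : Program Sg) (b : AttrTerm Sg)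
    (X Y : Set (TauLit Sg)) : Prop where
  selection : ∀ r ∈ Q.selection, r.attr = b → (HoldsAll X r.body ↔ HoldsAll Y r.body)
  range : ∀ r ∈ Q.selection, r.attr = b → ∀ y : Val Sg b,
    (InDynamicRange X r y ↔ InDynamicRange Y r y)
  prAtom : ∀ q ∈ Q.prAtoms, q.rule.attr = b → (HoldsAll X q.body ↔ HoldsAll Y q.body)

theorem SameCauses.generates_iff {Sg : Signature} {Q : Program Sg} {b : AttrTerm Sg}
    {X Y : Set (TauLit Sg)} (h : SameCauses Q b X Y) (r : SelectionRule Sg) (y : Val Sg b) :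
    Generates Q X r ⟨b, y⟩ ↔ Generates Q Y r ⟨b, y⟩ := by
  constructor
  · rintro ⟨hr, hb, hK, hy⟩
    exact ⟨hr, hb, (h.selection r hr hb).1 hK, (h.range r hr hb y).1 hy⟩
  · rintro ⟨hr, hb, hK, hy⟩
    exact ⟨hr, hb, (h.selection r hr hb).2 hK, (h.range r hr hb y).2 hy⟩

theorem SameCauses.possible_iff {Sg : Signature} {Q : Program Sg} {b : AttrTerm Sg}
    {X Y : Set (TauLit Sg)} (h : SameCauses Q b X Y) (y : Val Sg b) :
    Possible Q X ⟨b, y⟩ ↔ Possible Q Y ⟨b, y⟩ :=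
  exists_congr fun r => h.generates_iff r y

theorem SameCauses.assigns_eq {Sg : Signature} {Q : Program Sg} {b : AttrTerm Sg}
    {X Y : Set (TauLit Sg)} (h : SameCauses Q b X Y)
    (hi : .pos (.intervene b) ∈ X ↔ .pos (.intervene b) ∈ Y) (y : Val Sg b) :
    (fun q => Assigns Q X q ⟨b, y⟩) = fun q => Assigns Q Y q ⟨b, y⟩ := by
  funext q
  refine propext (and_congr_right fun hq => and_congr_right fun hx => ?_)
  have hqb : q.rule.attr = b := congrArg Sigma.fst hx
  rw [h.generates_iff, h.prAtom q hq hqb, hi]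

theorem SameCauses.hasPA_iff {Sg : Signature} {Q : Program Sg} {b : AttrTerm Sg}
    {X Y : Set (TauLit Sg)} (h : SameCauses Q b X Y)
    (hi : .pos (.intervene b) ∈ X ↔ .pos (.intervene b) ∈ Y) (y : Val Sg b) :
    HasPA Q X ⟨b, y⟩ ↔ HasPA Q Y ⟨b, y⟩ := by
  simp only [HasPA, congrFun (h.assigns_eq hi y)]

open Classical in
theorem SameCauses.PA_eq {Sg : Signature} {Q : Program Sg} {b : AttrTerm Sg}
    {X Y : Set (TauLit Sg)} (h : SameCauses Q b X Y)
    (hi : .pos (.intervene b) ∈ X ↔ .pos (.intervene b) ∈ Y) (y : Val Sg b) :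
    PA Q X ⟨b, y⟩ = PA Q Y ⟨b, y⟩ := by
  -- `PA` selects a pr-atom by choice, so the two predicates must be equal, which ensures that the
  -- same pr-atom is chosen even where several would qualify.
  have key : ∀ p p' : PrAtom Sg → Prop, p = p' →
      (if h : ∃ q, p q then h.choose.prob else 0) =
        if h : ∃ q, p' q then h.choose.prob else 0 := by
    rintro p _ rfl; rfl
  exact key _ _ (h.assigns_eq hi y)

open Classical in
theorem SameCauses.causalProb_eq {Sg : Signature} {Q : Program Sg} {b : AttrTerm Sg}
    {X Y : Set (TauLit Sg)} (h : SameCauses Q b X Y)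
    (hi : .pos (.intervene b) ∈ X ↔ .pos (.intervene b) ∈ Y) (y : Val Sg b) :
    causalProb Q X ⟨b, y⟩ = causalProb Q Y ⟨b, y⟩ := by
  simp only [causalProb, alpha, beta, h.hasPA_iff hi, h.PA_eq hi, h.possible_iff]

theorem SameCauses.weight_eq {Sg : Signature} {Q : Program Sg} {b : AttrTerm Sg}
    {X Y : Set (TauLit Sg)} (h : SameCauses Q b X Y)
    (hi : .pos (.intervene b) ∈ X ↔ .pos (.intervene b) ∈ Y)
    (hv : ∀ y : Val Sg b, .pos (.val ⟨b, y⟩) ∈ X ↔ .pos (.val ⟨b, y⟩) ∈ Y) :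
    weight Q X b = weight Q Y b := by
  simp only [weight, h.possible_iff, h.causalProb_eq hi, hv]

theorem weight_eq_causalProb {Sg : Signature} {Q : Program Sg} {X : Set (TauLit Sg)}
    {b : AttrTerm Sg} {y : Val Sg b} (hy : .pos (.val ⟨b, y⟩) ∈ X) (hp : Possible Q X ⟨b, y⟩)
    (huniq : ∀ y' : Val Sg b, .pos (.val ⟨b, y'⟩) ∈ X → y' = y) :
    weight Q X b = causalProb Q X ⟨b, y⟩ := by
  have : (Set.toFinite {y : Val Sg b | .pos (.val ⟨b, y⟩) ∈ X ∧
      Possible Q X ⟨b, y⟩}).toFinset = {y} := by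
    ext y'
    simp only [Set.Finite.mem_toFinset, Set.mem_ofPred_eq, Finset.mem_singleton]
    exact ⟨fun h => huniq y' h.1, fun h => h ▸ ⟨hy, hp⟩⟩
  rw [weight, this, Finset.prod_singleton]

/-- In a possible world of an admissible program, the generating rule is unique. -/
theorem Admissible.rule_eq {Sg : Signature} {Q : Program Sg} (hQ : Admissible Q)
    {X : Set (TauLit Sg)} (hX : X ∈ worlds Q) {r r' : SelectionRule Sg} (hr : r ∈ Q.selection)
    (hr' : r' ∈ Q.selection) (h : r.attr = r'.attr) (hb : HoldsAll X r.body)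
    (hb' : HoldsAll X r'.body) : r = r' := by
  by_contra hne
  exact hQ.uniqueSelection r hr r' hr' hne h X hX ⟨hb, hb'⟩

theorem Admissible.assigns {Sg : Signature} {Q : Program Sg} (hQ : Admissible Q)
    {X : Set (TauLit Sg)} (hX : X ∈ worlds Q) {q : PrAtom Sg} (hq : q ∈ Q.prAtoms)
    (hK : HoldsAll X q.rule.body) (hB : HoldsAll X q.body)
    (hi : .pos (.intervene q.rule.attr) ∉ X) : Assigns Q X q q.atom :=
  ⟨hq, rfl, ⟨Q.prAtoms_rule q hq, rfl, hK, hQ.assignmentInRange q hq X hX hK hB hi⟩, hB, hi⟩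

theorem Admissible.assigns_unique {Sg : Signature} {Q : Program Sg} (hQ : Admissible Q)
    {X : Set (TauLit Sg)} (hX : X ∈ worlds Q) {q q' : PrAtom Sg} {x : Atom Sg}
    (h : Assigns Q X q x) (h' : Assigns Q X q' x) : q = q' := by
  obtain ⟨hq, hqx, ⟨hr, hrx, hK, -⟩, hB, -⟩ := h
  obtain ⟨hq', hqx', ⟨hr', hrx', hK', -⟩, hB', -⟩ := h'
  have hrr := hQ.rule_eq hX hr hr' (hrx.trans hrx'.symm) hK hK'
  by_contra hne
  exact hQ.uniqueAssignment q hq q' hq' hne hrr (hqx.trans hqx'.symm) X hX ⟨hK, hB, hB'⟩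

theorem Admissible.PA_eq {Sg : Signature} {Q : Program Sg} (hQ : Admissible Q)
    {X : Set (TauLit Sg)} (hX : X ∈ worlds Q) {q : PrAtom Sg} {x : Atom Sg}
    (h : Assigns Q X q x) : PA Q X x = q.prob := by
  have hx : HasPA Q X x := ⟨q, h⟩
  rw [PA, dif_pos hx, hQ.assigns_unique hX hx.choose_spec h]

theorem Admissible.causalProb_eq {Sg : Signature} {Q : Program Sg} (hQ : Admissible Q)
    {X : Set (TauLit Sg)} (hX : X ∈ worlds Q) {q : PrAtom Sg} {x : Atom Sg}
    (h : Assigns Q X q x) : causalProb Q X x = q.prob := by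
  rw [causalProb, if_pos ⟨q, h⟩, hQ.PA_eq hX h]

theorem HasPA.possible {Sg : Signature} {Q : Program Sg} {X : Set (TauLit Sg)} {x : Atom Sg}
    (h : HasPA Q X x) : Possible Q X x := by
  obtain ⟨q, -, -, hg, -⟩ := h
  exact ⟨_, hg⟩

theorem HasPA.not_intervene {Sg : Signature} {Q : Program Sg} {X : Set (TauLit Sg)}
    {x : Atom Sg} (h : HasPA Q X x) : .pos (.intervene x.1) ∉ X := by
  obtain ⟨q, -, -, -, -, hi⟩ := h
  exact hi

/-- The values without assigned probability share `1 - α` equally, which completes the sum to 1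
unless there are no such values; only in that case is `α = 1` needed. -/
theorem sum_causalProb_eq {Sg : Signature} {Q : Program Sg} {X : Set (TauLit Sg)}
    {b : AttrTerm Sg} (h : beta Q X b = 0 → alpha Q X b = 1) :
    ∑ y ∈ (Set.toFinite {y : Val Sg b | Possible Q X ⟨b, y⟩}).toFinset,
      causalProb Q X ⟨b, y⟩ = 1 := by
  classical
  rw [← Finset.sum_filter_add_sum_filter_not _ fun y : Val Sg b => HasPA Q X ⟨b, y⟩]
  have h1 : ∑ y ∈ (Set.toFinite {y : Val Sg b | Possible Q X ⟨b, y⟩}).toFinset.filter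
      (fun y : Val Sg b => HasPA Q X ⟨b, y⟩), causalProb Q X ⟨b, y⟩ = alpha Q X b := by
    refine Finset.sum_congr ?_ fun y hy => ?_
    · ext y
      simp only [Finset.mem_filter, Set.Finite.mem_toFinset, Set.mem_ofPred_eq,
        and_iff_right_iff_imp]
      exact HasPA.possible
    · simp only [Set.Finite.mem_toFinset, Set.mem_ofPred_eq] at hy
      rw [causalProb, if_pos hy]
  have h2 : ∑ y ∈ (Set.toFinite {y : Val Sg b | Possible Q X ⟨b, y⟩}).toFinset.filter
      (fun y : Val Sg b => ¬ HasPA Q X ⟨b, y⟩), causalProb Q X ⟨b, y⟩ =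
      (beta Q X b : ℝ) * ((1 - alpha Q X b) / (beta Q X b : ℝ)) := by
    have hcard : ((Set.toFinite {y : Val Sg b | Possible Q X ⟨b, y⟩}).toFinset.filter
        fun y : Val Sg b => ¬ HasPA Q X ⟨b, y⟩).card = beta Q X b := by
      rw [beta, Set.ncard_eq_toFinset_card _ (Set.toFinite _)]
      congr 1
      ext y
      simp
    rw [← hcard, ← nsmul_eq_mul]
    refine Finset.sum_eq_card_nsmul fun y hy => ?_
    rw [causalProb, if_neg (Finset.mem_filter.1 hy).2, hcard]
  rw [h1, h2]
  by_cases hβ : beta Q X b = 0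
  · simp [hβ, h hβ]
  · rw [mul_div_cancel₀ _ (Nat.cast_ne_zero.2 hβ)]
    ring

/-- In a possible world of a unitary program, the causal probabilities of the possible values of
an active attribute term sum to one. -/
theorem sum_causalProb_eq_one {Sg : Signature} {Q : Program Sg} (hQ : Admissible Q)
    (hU : Unitary Q) {X : Set (TauLit Sg)} (hX : X ∈ worlds Q) {b : AttrTerm Sg}
    (hact : Active Q X b) :
    ∑ y ∈ (Set.toFinite {y : Val Sg b | Possible Q X ⟨b, y⟩}).toFinset,
      causalProb Q X ⟨b, y⟩ = 1 := by
  classical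
  refine sum_causalProb_eq fun hβ => ?_
  have hall : ∀ y : Val Sg b, Possible Q X ⟨b, y⟩ → HasPA Q X ⟨b, y⟩ := by
    intro y hy
    by_contra hno
    rw [beta, Set.ncard_eq_zero (Set.toFinite _)] at hβ
    exact (hβ.subset ⟨hy, hno⟩ : y ∈ (∅ : Set (Val Sg b)))
  obtain ⟨y₀, hy₀⟩ := hact
  -- Under an intervention nothing is assigned, so an active term would have `β > 0`. Only the case
  -- without intervention remains, where the scenario of `X` is decisive.
  have hi : .pos (.intervene b) ∉ X := (hall y₀ hy₀).not_intervene
  obtain ⟨r, hr, hrb, hK, hr₀⟩ := hy₀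
  obtain rfl : r.attr = b := hrb
  have hposs : ∀ y : Val Sg r.attr, InDynamicRange X r y → Possible Q X ⟨r.attr, y⟩ :=
    fun y hy => ⟨r, hr, rfl, hK, hy⟩
  set s : Set (Set (TauLit Sg)) :=
    {W' | W' ∈ worlds Q ∧ HoldsAll W' r.body ∧ ProbEquiv Q r X W'} with hs
  have hXs : X ∈ s := ⟨hX, hK, fun y => Iff.rfl, fun q hq hqr => Iff.rfl⟩
  have hactive : ∀ q, q ∈ activePrAtoms Q r s ↔
      q ∈ Q.prAtoms ∧ q.rule = r ∧ HoldsAll X q.body := by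
    intro q
    simp only [activePrAtoms, Finset.mem_filter]
    refine and_congr_right fun hq => and_congr_right fun hqr => ⟨fun h => h X hXs, ?_⟩
    rintro h W ⟨-, -, -, hW⟩
    exact (hW q hq hqr).1 h
  have hassigns : ∀ q ∈ activePrAtoms Q r s, Assigns Q X q q.atom := by
    intro q hq
    obtain ⟨hq', hqr, hB⟩ := (hactive q).1 hq
    subst hqr
    exact hQ.assigns hX hq' hK hB hi
  have hback : ∀ q x, x.1 = r.attr → Assigns Q X q x → q ∈ activePrAtoms Q r s := by
    rintro q x hx ⟨hq, rfl, ⟨hr', -, hK', -⟩, hB, -⟩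
    exact (hactive q).2 ⟨hq, hQ.rule_eq hX hr' hr hx hK' hK, hB⟩
  have halpha : alpha Q X r.attr = ∑ q ∈ activePrAtoms Q r s, q.prob := by
    rw [alpha]
    have hmem : ∀ y : Val Sg r.attr,
        y ∈ (Set.toFinite {y : Val Sg r.attr | HasPA Q X ⟨r.attr, y⟩}).toFinset →
        HasPA Q X ⟨r.attr, y⟩ := fun y hy => by simpa using hy
    -- By admissibility, assigned values correspond one-to-one to the pr-atoms active in the
    -- scenario.
    refine Finset.sum_bij (fun y hy => (hmem y hy).choose) ?_ ?_ ?_ ?_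
    · exact fun y hy => hback _ _ rfl (hmem y hy).choose_spec
    · intro y hy y' hy' heq
      have h1 := (hmem y hy).choose_spec.2.1
      have h2 := (hmem y' hy').choose_spec.2.1
      rw [heq, h2] at h1
      simpa using h1.symm
    · intro q hq
      have hqa := hassigns q hq
      obtain ⟨hq', hqr, hB⟩ := (hactive q).1 hq
      subst hqr
      refine ⟨q.val, by simpa using ⟨q, hqa⟩, ?_⟩
      exact hQ.assigns_unique hX (hmem q.val (by simpa using ⟨q, hqa⟩)).choose_spec hqa
    · exact fun y hy => hQ.PA_eq hX (hmem y hy).choose_spec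
  rcases hU r hr s ⟨X, hX, hK, rfl⟩ with ⟨-, h1⟩ | ⟨⟨y, ⟨W, hW, hy⟩, hno⟩, -⟩
  · rw [halpha, h1]
  · obtain ⟨q, hq⟩ := hall y (hposs y ((hW.2.2.1 y).2 hy))
    exact absurd ⟨q, hback q _ rfl hq, hq.2.1⟩ hno

/-! ### The stages of a causally ordered program -/

/-- The enumeration `a` of the random attribute terms of `Q`, increasing with respect to the
strict probabilistic leveling `lvl`, witnesses that `Q` is causally ordered. -/
structure CausalOrder {Sg : Signature} (Q : Program Sg) (lvl : AttrTerm Sg → ℕ) {n : ℕ}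
    (a : Fin n → AttrTerm Sg) : Prop where
  leveling : StrictLeveling Q lvl
  range_eq : Set.range a = randomTerms Q
  strictMono : StrictMono fun i => lvl (a i)
  base : ∃! W, W ∈ worlds (stage Q a 0)
  active : ∀ i : Fin n, ∀ W ∈ worlds (stage Q a i), ∀ y : Val Sg (a i),
    Possible (stage Q a (i + 1)) W ⟨a i, y⟩ →
      ∃! X, X ∈ worldsWith W (observe (stage Q a (i + 1)) {.lit (.pos ⟨a i, y⟩)})
  inactive : ∀ i : Fin n, ∀ W ∈ worlds (stage Q a i), ¬ Active (stage Q a (i + 1)) W (a i) →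
    ∃! X, X ∈ worldsWith W (stage Q a (i + 1))

theorem CausallyOrdered.exists_causalOrder {Sg : Signature} {Q : Program Sg}
    (h : CausallyOrdered Q) :
    ∃ (lvl : AttrTerm Sg → ℕ) (n : ℕ) (a : Fin n → AttrTerm Sg), CausalOrder Q lvl a := by
  obtain ⟨lvl, hl, n, a, hr, hm, hb, hs⟩ := h
  exact ⟨lvl, n, a, hl, hr, hm, hb, fun i W hW => (hs i W hW).1, fun i W hW => (hs i W hW).2⟩

theorem language_mono {Sg : Signature} (Q : Program Sg) {n : ℕ} (a : Fin n → AttrTerm Sg)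
    {k m : ℕ} (h : k ≤ m) : language Q a k ⊆ language Q a m :=
  fun _ hl j hj => hl j (h.trans hj)

theorem mem_language_last {Sg : Signature} (Q : Program Sg) {n : ℕ} (a : Fin n → AttrTerm Sg)
    (l : Lit Sg) : l ∈ language Q a n :=
  fun j hj => absurd j.2 (not_lt.2 hj)

theorem worlds_stage_last {Sg : Signature} (Q : Program Sg) {n : ℕ} (a : Fin n → AttrTerm Sg) :
    worlds (stage Q a n) = worlds Q := by
  have hl := mem_language_last Q a
  have : tau (stage Q a n) = tau Q :=
    (tau_mono (Q := stage Q a n) (Q' := Q) (fun _ h => h.1) (fun _ h => h.1) (fun _ h => h.1) fun _ h => h.1).antisymm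
      (tau_mono (fun _ h => ⟨h, fun l _ => hl l, fun l _ => hl l⟩)
        (fun _ h => ⟨h, fun l _ => hl l, fun l _ => hl l⟩)
        (fun _ h => ⟨h, hl _⟩) fun _ h => ⟨h, hl _⟩)
  simp only [worlds, this]

theorem holdsAll_union {Sg : Signature} {W : Set (TauLit Sg)} {B C : Set (ExtLit Sg)} :
    HoldsAll W (B ∪ C) ↔ HoldsAll W B ∧ HoldsAll W C :=
  ⟨fun h => ⟨fun e he => h e (Or.inl he), fun e he => h e (Or.inr he)⟩,
    fun h e he => he.elim (h.1 e) (h.2 e)⟩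

theorem holdsAll_congr {Sg : Signature} {L : Set (Lit Sg)} {X Y : Set (TauLit Sg)}
    (h : ∀ l ∈ L, (tauLit l ∈ X ↔ tauLit l ∈ Y)) {B : Set (ExtLit Sg)}
    (hB : ∀ l, Mentions B l → l ∈ L) : HoldsAll X B ↔ HoldsAll Y B := by
  refine forall₂_congr fun e he => ?_
  have := h _ (hB e.literal ⟨e, he, rfl⟩)
  cases e with
  | lit l => exact this
  | naf l => exact not_congr this

theorem tauLit_mem_project_iff {Sg : Signature} {Q : Program Sg} {X : Set (TauLit Sg)}
    (hX : X ∈ worlds Q) {L : Set (Lit Sg)} {l : Lit Sg} (hl : l ∈ L) :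
    tauLit l ∈ project L X ↔ tauLit l ∈ X :=
  ⟨fun h => project_subset (IsAnswerSet.reductModel hX) L h,
    fun h => mem_project_of_mem h (tauLit_mem_tauLanguage.2 hl)⟩

theorem project_project {Sg : Signature} {Q : Program Sg} {X : Set (TauLit Sg)}
    (hX : X ∈ worlds Q) {L L' : Set (Lit Sg)} (h : L ⊆ L') :
    project L (project L' X) = project L X := by
  refine project_congr ?_
  rw [← Set.inter_eq_right.2 (tauLanguage_mono h), ← Set.inter_assoc, ← Set.inter_assoc,
    project_inter (IsAnswerSet.reductModel hX)]

/-! ### The tree formed by the possible worlds of the stages -/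

namespace CausalOrder

variable {Sg : Signature} {Q : Program Sg} {lvl : AttrTerm Sg → ℕ} {n : ℕ}
  {a : Fin n → AttrTerm Sg}

theorem random (h : CausalOrder Q lvl a) (i : Fin n) : a i ∈ randomTerms Q :=
  h.range_eq ▸ ⟨i, rfl⟩

theorem injective (h : CausalOrder Q lvl a) : Function.Injective a :=
  fun _ _ hij => h.strictMono.injective (congrArg lvl hij)

/-- A literal depending on a random term has at least its level, and the terms `a j` with `j ≥ k`
have level at least that of `a k`. -/
theorem mem_language_of_lt (h : CausalOrder Q lvl a) {k : Fin n} {l : Lit Sg}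
    (hl : lvl l.atom.1 < lvl (a k)) : l ∈ language Q a k := by
  intro j hj l' hl' hdep
  have h1 := h.leveling.depends (a j) (h.random j) l.atom.1 ⟨l, l', rfl, hl', hdep⟩
  have h2 : lvl (a k) ≤ lvl (a j) := h.strictMono.monotone hj
  omega

theorem mem_language_iff (h : CausalOrder Q lvl a) {j : Fin n} {l : Lit Sg}
    (hl : l.atom.1 = a j) {m : ℕ} : l ∈ language Q a m ↔ (j : ℕ) < m := by
  constructor
  · intro hm
    by_contra hj
    exact hm j (not_lt.1 hj) l hl .refl
  · intro hj i hi l' hl' hdep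
    have h1 := h.leveling.depends (a i) (h.random i) (a j) ⟨l, l', hl, hl', hdep⟩
    have h2 : lvl (a j) < lvl (a i) := h.strictMono (show j < i from hj.trans_le hi)
    omega

theorem dependencyClosed (h : CausalOrder Q lvl a) (m : ℕ) :
    DependencyClosed Q (language Q a m) where
  immDep l hl l' hdep := fun j hj l'' hl'' hdep' => hl j hj l'' hl'' (.head hdep hdep')
  heads r hr y y' hy := by
    obtain ⟨j, hj⟩ : r.attr ∈ Set.range a := h.range_eq ▸ ⟨r, hr, rfl⟩
    exact (h.mem_language_iff (l := .pos ⟨r.attr, y'⟩) hj.symm).2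
      ((h.mem_language_iff (l := .pos ⟨r.attr, y⟩) hj.symm).1 hy)

theorem body_subset (h : CausalOrder Q lvl a) {k : Fin n} {r : SelectionRule Sg}
    (hr : r ∈ Q.selection) (hk : r.attr = a k) {l : Lit Sg} (hl : Mentions r.body l) :
    l ∈ language Q a k :=
  h.mem_language_of_lt (hk ▸ h.leveling.selection_body r hr l hl)

theorem prAtom_body_subset (h : CausalOrder Q lvl a) {k : Fin n} {q : PrAtom Sg}
    (hq : q ∈ Q.prAtoms) (hk : q.rule.attr = a k) {l : Lit Sg} (hl : Mentions q.body l) :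
    l ∈ language Q a k :=
  h.mem_language_of_lt (hk ▸ h.leveling.prAtom_body q hq l hl)

theorem inDynamicRange_congr (h : CausalOrder Q lvl a) {k : Fin n} {X Y : Set (TauLit Sg)}
    (hXY : ∀ l ∈ language Q a k, (tauLit l ∈ X ↔ tauLit l ∈ Y)) {r : SelectionRule Sg}
    (hr : r ∈ Q.selection) (hk : r.attr = a k) (y : Val Sg (a k)) :
    InDynamicRange X r y ↔ InDynamicRange Y r y := by
  refine forall₂_congr fun p hp => exists_congr fun l => and_congr_right fun hl => hXY l ?_
  refine h.mem_language_of_lt ?_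
  have := h.leveling.selection_range r hr p hp
  rw [hk] at this
  exact this y l hl

/-- The causes of `a k` are formed from the literals of the `k`-th language. -/
theorem sameCauses (h : CausalOrder Q lvl a) {k : Fin n} {X Y : Set (TauLit Sg)}
    (hXY : ∀ l ∈ language Q a k, (tauLit l ∈ X ↔ tauLit l ∈ Y)) : SameCauses Q (a k) X Y where
  selection _ hr hk := holdsAll_congr hXY fun _ hl => h.body_subset hr hk hl
  range _ hr hk y := h.inDynamicRange_congr hXY hr hk y
  prAtom _ hq hk := holdsAll_congr hXY fun _ hl => h.prAtom_body_subset hq hk hl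

theorem project_mem (h : CausalOrder Q lvl a) {k m : ℕ} (hkm : k ≤ m) {X : Set (TauLit Sg)}
    (hX : X ∈ worlds (stage Q a m)) : project (language Q a k) X ∈ worlds (stage Q a k) :=
  (h.dependencyClosed k).project_mem_worlds (language_mono Q a hkm) hX

theorem intervene_iff (h : CausalOrder Q lvl a) {m : ℕ} {X : Set (TauLit Sg)}
    (hX : X ∈ worlds (stage Q a m)) {j : Fin n} (hj : (j : ℕ) < m) :
    .pos (.intervene (a j)) ∈ X ↔ ∃ y : Val Sg (a j), (⟨a j, y⟩ : Atom Sg) ∈ Q.acts := by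
  rw [intervene_mem_iff hX]
  exact exists_congr fun y => ⟨fun hy => hy.1,
    fun hy => ⟨hy, (h.mem_language_iff (l := .pos ⟨a j, y⟩) rfl).2 hj⟩⟩

/-- The value `y` provides a head literal. With an empty range the rule would create no dependency
on its body, and closure of the language could not be invoked. -/
theorem selection_mem_stage (h : CausalOrder Q lvl a) {k : Fin n} {r : SelectionRule Sg}
    (hr : r ∈ Q.selection) (hk : r.attr = a k) (y : Val Sg r.attr) :
    r ∈ (stage Q a (k + 1)).selection := by
  have hhead : ∀ y : Val Sg r.attr, Literal.pos ⟨r.attr, y⟩ ∈ language Q a (k + 1) :=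
    fun y => (h.mem_language_iff (l := .pos ⟨r.attr, y⟩) hk).2 (Nat.lt_succ_self _)
  refine ⟨hr, ?_, fun l hl => (h.dependencyClosed _).immDep _ (hhead y) l
    (.select r hr _ l ⟨y, rfl⟩ hl)⟩
  rintro _ ⟨y', rfl⟩
  exact hhead y'

theorem possible_stage_iff (h : CausalOrder Q lvl a) {k : Fin n} {W : Set (TauLit Sg)}
    {y : Val Sg (a k)} :
    Possible (stage Q a (k + 1)) W ⟨a k, y⟩ ↔ Possible Q W ⟨a k, y⟩ := by
  constructor
  · rintro ⟨r, hr, hx, hb⟩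
    exact ⟨r, hr.1, hx, hb⟩
  · rintro ⟨r, hr, hx, hb⟩
    exact ⟨r, h.selection_mem_stage hr hx (cast (congrArg (Val Sg) hx.symm) y), hx, hb⟩

/-- Causal ordering gives uniqueness for the next stage with `W` as facts and the value observed.
Splitting turns the facts into the condition on the projection, and the observation becomes a
filter. -/
theorem existsUnique_child_of_possible (h : CausalOrder Q lvl a) {k : Fin n}
    {W : Set (TauLit Sg)} (hW : W ∈ worlds (stage Q a k)) {y : Val Sg (a k)}
    (hy : Possible Q W ⟨a k, y⟩) :
    ∃! X, X ∈ worlds (stage Q a (k + 1)) ∧ project (language Q a k) X = W ∧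
      .pos (.val ⟨a k, y⟩) ∈ X := by
  have hiff := fun X => (h.dependencyClosed k).mem_worldsWith_iff
    (language_mono Q a (Nat.le_succ k)) (X := X) hW
  obtain ⟨Y, hY, hYu⟩ := h.active k W hW y (h.possible_stage_iff.2 hy)
  obtain ⟨X, hX, hXB, rfl⟩ := exists_of_isAnswerSet_observe hY
  have hF : ∀ e, .neg (.obs e) ∉ W := by
    have hW' : IsAnswerSet (tau (stage Q a k) ∪ fact '' ∅) W := by
      rw [Set.image_empty, Set.union_empty]; exact hW
    exact neg_obs_notMem hW' (by simp)
  obtain ⟨hXw, hXp⟩ := (hiff X).1 hX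
  refine ⟨X, ⟨hXw, hXp, hXB _ rfl⟩, ?_⟩
  rintro Z ⟨hZw, hZp, hZy⟩
  have hZ := (hiff Z).2 ⟨hZw, hZp⟩
  refine union_obsFacts_injective hZ hX (hYu _ (isAnswerSet_observe hZ hF ?_))
  rintro e rfl
  exact hZy

theorem existsUnique_child_of_inactive (h : CausalOrder Q lvl a) {k : Fin n}
    {W : Set (TauLit Sg)} (hW : W ∈ worlds (stage Q a k)) (hact : ¬ Active Q W (a k)) :
    ∃! X, X ∈ worlds (stage Q a (k + 1)) ∧ project (language Q a k) X = W := by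
  have hiff := fun X => (h.dependencyClosed k).mem_worldsWith_iff
    (language_mono Q a (Nat.le_succ k)) (X := X) hW
  obtain ⟨X, hX, hXu⟩ := h.inactive k W hW fun ⟨y, hy⟩ => hact ⟨y, h.possible_stage_iff.1 hy⟩
  exact ⟨X, (hiff X).1 hX, fun Z hZ => hXu Z ((hiff Z).2 hZ)⟩

theorem exists_child (h : CausalOrder Q lvl a) {k : Fin n} {W : Set (TauLit Sg)}
    (hW : W ∈ worlds (stage Q a k)) :
    ∃ X ∈ worlds (stage Q a (k + 1)), project (language Q a k) X = W := by
  by_cases hact : Active Q W (a k)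
  · obtain ⟨y, hy⟩ := hact
    obtain ⟨X, ⟨hX, hXW, -⟩, -⟩ := h.existsUnique_child_of_possible hW hy
    exact ⟨X, hX, hXW⟩
  · obtain ⟨X, ⟨hX, hXW⟩, -⟩ := h.existsUnique_child_of_inactive hW hact
    exact ⟨X, hX, hXW⟩

/-- Every possible world of a stage extends to possible worlds of all later stages. -/
theorem exists_extension (h : CausalOrder Q lvl a) {k m : ℕ} (hkm : k ≤ m) (hm : m ≤ n)
    {W : Set (TauLit Sg)} (hW : W ∈ worlds (stage Q a k)) :
    ∃ X ∈ worlds (stage Q a m), project (language Q a k) X = W := by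
  induction m, hkm using Nat.le_induction with
  | base => exact ⟨W, hW, (h.dependencyClosed k).project_self hW⟩
  | succ m hkm ih =>
    obtain ⟨X, hX, rfl⟩ := ih (Nat.le_of_succ_le hm)
    obtain ⟨Y, hY, rfl⟩ := h.exists_child (k := ⟨m, hm⟩) hX
    exact ⟨Y, hY, (project_project hY (language_mono Q a hkm)).symm⟩

theorem exists_full_extension (h : CausalOrder Q lvl a) {k : ℕ} (hk : k ≤ n)
    {W : Set (TauLit Sg)} (hW : W ∈ worlds (stage Q a k)) :
    ∃ X ∈ worlds Q, project (language Q a k) X = W := by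
  obtain ⟨X, hX, hXW⟩ := h.exists_extension hk le_rfl hW
  exact ⟨X, worlds_stage_last Q a ▸ hX, hXW⟩

theorem sameCauses_project (h : CausalOrder Q lvl a) {k : Fin n} {m : ℕ} (hkm : k ≤ m)
    {P : Program Sg} {X : Set (TauLit Sg)} (hX : X ∈ worlds P) :
    SameCauses Q (a k) (project (language Q a m) X) X :=
  h.sameCauses fun _ hl => tauLit_mem_project_iff hX (language_mono Q a hkm hl)

/-- In a stage where `a k` is active, it takes a possible value. -/
theorem exists_possible_val (h : CausalOrder Q lvl a) {k : Fin n} {X : Set (TauLit Sg)}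
    (hX : X ∈ worlds (stage Q a (k + 1))) (hact : Active Q X (a k)) :
    ∃ y : Val Sg (a k), .pos (.val ⟨a k, y⟩) ∈ X ∧ Possible Q X ⟨a k, y⟩ := by
  obtain ⟨y₀, hy₀⟩ := hact
  -- An intervention fixes the value in every child. The child that realizes the possible value `y₀`
  -- also contains the imposed value, so the two coincide.
  by_cases hi : .pos (.intervene (a k)) ∈ X
  · obtain ⟨y', hy'⟩ := (intervene_mem_iff hX _).1 hi
    obtain ⟨Y, ⟨hY, -, hYy⟩, -⟩ := h.existsUnique_child_of_possible
      (h.project_mem (Nat.le_succ k) hX)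
      (((h.sameCauses_project le_rfl hX).possible_iff y₀).2 hy₀)
    obtain rfl := val_unique hY hYy (val_mem_of_act hY hy')
    exact ⟨y₀, val_mem_of_act hX hy', hy₀⟩
  · obtain ⟨r, hr, hrk, hb, hy₀⟩ := hy₀
    have hr' := h.selection_mem_stage hr hrk (cast (congrArg (Val Sg) hrk.symm) y₀)
    obtain ⟨y, hy, hyr⟩ := exists_val_of_selection hX hr' hb (by rwa [hrk])
    have key : ∀ (b : AttrTerm Sg) (y : Val Sg b), b = a k → .pos (.val ⟨b, y⟩) ∈ X →
        InDynamicRange X r y → ∃ y : Val Sg (a k), .pos (.val ⟨a k, y⟩) ∈ X ∧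
          Possible Q X ⟨a k, y⟩ := by
      rintro b y rfl hy hyr
      exact ⟨y, hy, r, hr, hrk, hb, hyr⟩
    exact key _ y hrk hy hyr

end CausalOrder

/-! ### Measures of the stages -/

/-- The unnormalized measure of a possible world of the `k`-th stage. -/
noncomputable def stageMeasure {Sg : Signature} (Q : Program Sg) {n : ℕ}
    (a : Fin n → AttrTerm Sg) (k : ℕ) (X : Set (TauLit Sg)) : ℝ :=
  ∏ i ∈ Finset.univ.filter (fun i : Fin n => (i : ℕ) < k), weight Q X (a i)

/-- The total unnormalized measure of the possible worlds of the `k`-th stage that satisfy `C`. -/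
noncomputable def stageSum {Sg : Signature} (Q : Program Sg) {n : ℕ}
    (a : Fin n → AttrTerm Sg) (k : ℕ) (C : Set (ExtLit Sg)) : ℝ :=
  ∑ X ∈ (Set.toFinite {X | X ∈ worlds (stage Q a k) ∧ HoldsAll X C}).toFinset,
    stageMeasure Q a k X

/-! ### Summation over the tree -/

namespace CausalOrder

variable {Sg : Signature} {Q : Program Sg} {lvl : AttrTerm Sg → ℕ} {n : ℕ}
  {a : Fin n → AttrTerm Sg}

/-- The weights of the terms before stage `k` are determined by literals of its language and by the
actions, so they are constant on the fibres of the projection. -/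
theorem stageMeasure_project (h : CausalOrder Q lvl a) {k m : ℕ} (hkm : k ≤ m)
    {X : Set (TauLit Sg)} (hX : X ∈ worlds (stage Q a m)) :
    stageMeasure Q a k (project (language Q a k) X) = stageMeasure Q a k X := by
  refine Finset.prod_congr rfl fun i hi => ?_
  have hik : (i : ℕ) < k := (Finset.mem_filter.1 hi).2
  refine (h.sameCauses_project hik.le hX).weight_eq ?_ fun y => ?_
  · rw [h.intervene_iff (h.project_mem hkm hX) hik, h.intervene_iff hX (hik.trans_le hkm)]
  · exact tauLit_mem_project_iff hX (l := .pos ⟨a i, y⟩) ((h.mem_language_iff rfl).2 hik)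

theorem stageMeasure_succ (k : Fin n) (X : Set (TauLit Sg)) :
    stageMeasure Q a (k + 1) X = stageMeasure Q a k X * weight Q X (a k) := by
  classical
  have : (Finset.univ.filter fun i : Fin n => (i : ℕ) < k + 1) =
      insert k (Finset.univ.filter fun i : Fin n => (i : ℕ) < k) := by
    ext i
    simp only [Finset.mem_filter, Finset.mem_univ, true_and, Finset.mem_insert, Fin.ext_iff]
    omega
  rw [stageMeasure, this, Finset.prod_insert (by simp), mul_comm]
  rfl

theorem muHat_eq_stageMeasure (h : CausalOrder Q lvl a) (X : Set (TauLit Sg)) :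
    muHat Q X = stageMeasure Q a n X := by
  rw [muHat_eq_prod_weight Q X h.injective h.range_eq, stageMeasure]
  congr 1
  ext i
  simp

/-- Splitting the sum over the worlds of a stage along the worlds of the previous stage. -/
theorem stageSum_succ (h : CausalOrder Q lvl a) {k : Fin n} {C D : Set (ExtLit Sg)}
    (hC : ∀ l, Mentions C l → l ∈ language Q a k) {c : ℝ}
    (hc : ∀ W ∈ worlds (stage Q a k), HoldsAll W C →
      ∑ X ∈ (Set.toFinite {X | X ∈ worlds (stage Q a (k + 1)) ∧
        project (language Q a k) X = W ∧ HoldsAll X D}).toFinset, weight Q X (a k) = c) :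
    stageSum Q a (k + 1) (C ∪ D) = c * stageSum Q a k C := by
  classical
  have hCX : ∀ X ∈ worlds (stage Q a (k + 1)),
      (HoldsAll (project (language Q a k) X) C ↔ HoldsAll X C) := fun X hX =>
    holdsAll_congr (fun l hl => tauLit_mem_project_iff hX hl) hC
  rw [stageSum, stageSum, ← Finset.sum_fiberwise_of_maps_to (g := project (language Q a k))
    (t := (Set.toFinite {X | X ∈ worlds (stage Q a k) ∧ HoldsAll X C}).toFinset), Finset.mul_sum]
  · refine Finset.sum_congr rfl fun W hW => ?_
    obtain ⟨hW, hWC⟩ := (Set.Finite.mem_toFinset _).1 hW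
    rw [← hc W hW hWC, Finset.sum_mul]
    refine Finset.sum_congr ?_ fun X hX => ?_
    · ext X
      simp only [Finset.mem_filter, Set.Finite.mem_toFinset, Set.mem_ofPred_eq, holdsAll_union]
      constructor
      · rintro ⟨⟨hX, -, hD⟩, hXW⟩
        exact ⟨hX, hXW, hD⟩
      · rintro ⟨hX, rfl, hD⟩
        exact ⟨⟨hX, (hCX X hX).1 hWC, hD⟩, rfl⟩
    · obtain ⟨hX', rfl, -⟩ := (Set.Finite.mem_toFinset _).1 hX
      rw [stageMeasure_succ, h.stageMeasure_project (Nat.le_succ _) hX', mul_comm]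
  · intro X hX
    obtain ⟨hX, hXC⟩ := (Set.Finite.mem_toFinset _).1 hX
    rw [Set.Finite.mem_toFinset]
    exact ⟨h.project_mem (Nat.le_succ _) hX, (hCX X hX).2 (holdsAll_union.1 hXC).1⟩

/-- The extensions of `W` in which `a k` takes the possible value `y`. -/
theorem sum_weight_of_possible (h : CausalOrder Q lvl a) {k : Fin n} {X : Set (TauLit Sg)}
    (hX : X ∈ worlds Q) {y : Val Sg (a k)} (hy : Possible Q X ⟨a k, y⟩) :
    ∑ Y ∈ (Set.toFinite {Y | Y ∈ worlds (stage Q a (k + 1)) ∧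
      project (language Q a k) Y = project (language Q a k) X ∧
        HoldsAll Y {.lit (.pos ⟨a k, y⟩)}}).toFinset, weight Q Y (a k) =
      causalProb Q X ⟨a k, y⟩ := by
  have hXn : X ∈ worlds (stage Q a n) := by rwa [worlds_stage_last]
  have hWX := h.sameCauses_project (k := k) le_rfl hXn
  obtain ⟨Y, ⟨hY, hYW, hYy⟩, hYu⟩ := h.existsUnique_child_of_possible
    (h.project_mem k.2.le hXn) ((hWX.possible_iff y).2 hy)
  have hsing : (Set.toFinite {Y | Y ∈ worlds (stage Q a (k + 1)) ∧
      project (language Q a k) Y = project (language Q a k) X ∧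
        HoldsAll Y {.lit (.pos ⟨a k, y⟩)}}).toFinset = {Y} := by
    ext Z
    simp only [Set.Finite.mem_toFinset, Finset.mem_singleton]
    constructor
    · rintro ⟨hZ, hZW, hZy⟩
      exact hYu Z ⟨hZ, hZW, hZy _ rfl⟩
    · rintro rfl
      refine ⟨hY, hYW, ?_⟩
      rintro e rfl
      exact hYy
  have hYX : SameCauses Q (a k) Y X := h.sameCauses fun l hl => by
    rw [← tauLit_mem_project_iff hY hl, hYW, tauLit_mem_project_iff hXn hl]
  rw [hsing, Finset.sum_singleton, weight_eq_causalProb hYy ((hYX.possible_iff y).2 hy)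
    fun y' hy' => val_unique hY hy' hYy]
  refine hYX.causalProb_eq ?_ y
  rw [h.intervene_iff hY (Nat.lt_succ_self _), h.intervene_iff hXn k.2]

/-- The node is presented as the projection of a full world `X`, because admissibility and unitarity
are hypotheses on worlds of the whole program. -/
theorem sum_weight_eq_one (h : CausalOrder Q lvl a) (hadm : Admissible Q) (hunit : Unitary Q)
    {k : Fin n} {X : Set (TauLit Sg)} (hX : X ∈ worlds Q) :
    ∑ Y ∈ (Set.toFinite {Y | Y ∈ worlds (stage Q a (k + 1)) ∧
      project (language Q a k) Y = project (language Q a k) X}).toFinset,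
        weight Q Y (a k) = 1 := by
  classical
  have hXn : X ∈ worlds (stage Q a n) := by rwa [worlds_stage_last]
  have hWX := h.sameCauses_project (k := k) le_rfl hXn
  have hYX : ∀ Y, Y ∈ worlds (stage Q a (k + 1)) →
      project (language Q a k) Y = project (language Q a k) X → SameCauses Q (a k) Y X :=
    fun Y hY hYW => h.sameCauses fun l hl => by
      rw [← tauLit_mem_project_iff hY hl, hYW, tauLit_mem_project_iff hXn hl]
  by_cases hact : Active Q X (a k)
  · rw [← sum_causalProb_eq_one hadm hunit hX hact]
    have hrw : ∀ y ∈ (Set.toFinite {y : Val Sg (a k) | Possible Q X ⟨a k, y⟩}).toFinset,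
        causalProb Q X ⟨a k, y⟩ = ∑ Y ∈ (Set.toFinite {Y | Y ∈ worlds (stage Q a (k + 1)) ∧
          project (language Q a k) Y = project (language Q a k) X}).toFinset,
          if .pos (.val ⟨a k, y⟩) ∈ Y then weight Q Y (a k) else 0 := by
      intro y hy
      rw [← h.sum_weight_of_possible hX (by simpa using hy), ← Finset.sum_filter]
      refine Finset.sum_congr ?_ fun _ _ => rfl
      ext Y
      simp only [Set.Finite.mem_toFinset, Finset.mem_filter, Set.mem_ofPred_eq, and_assoc]
      refine and_congr_right fun _ => and_congr_right fun _ => ⟨fun hY => hY _ rfl, ?_⟩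
      rintro hY e rfl
      exact hY
    -- After the interchange, each child is counted once: it contains exactly one possible value of
    -- `a k`.
    rw [Finset.sum_congr rfl hrw, Finset.sum_comm]
    refine Finset.sum_congr rfl fun Y hY => ?_
    obtain ⟨hY, hYW⟩ := (Set.Finite.mem_toFinset _).1 hY
    have hsc := hYX Y hY hYW
    obtain ⟨y, hy, hyp⟩ := h.exists_possible_val hY
      (hact.imp fun y hy => (hsc.possible_iff y).2 hy)
    rw [Finset.sum_eq_single_of_mem y (by simpa using (hsc.possible_iff y).1 hyp)]
    · rw [if_pos hy]
    · intro y' _ hne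
      exact if_neg fun hy' => hne (val_unique hY hy' hy)
  · obtain ⟨Y, hY, hYu⟩ := h.existsUnique_child_of_inactive (h.project_mem k.2.le hXn)
      fun ⟨y, hy⟩ => hact ⟨y, (hWX.possible_iff y).1 hy⟩
    have hsing : (Set.toFinite {Y | Y ∈ worlds (stage Q a (k + 1)) ∧
        project (language Q a k) Y = project (language Q a k) X}).toFinset = {Y} := by
      ext Z
      simp only [Set.Finite.mem_toFinset, Finset.mem_singleton]
      exact ⟨fun hZ => hYu Z hZ, fun hZ => hZ ▸ hY⟩
    rw [hsing, Finset.sum_singleton]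
    exact weight_eq_one fun y hy => hact ⟨y, ((hYX Y hY.1 hY.2).possible_iff y).1 hy⟩

/-- Each later stage distributes the mass of a node among its children without loss and does not
change the truth of `C`. -/
theorem stageSum_eq (h : CausalOrder Q lvl a) (hadm : Admissible Q) (hunit : Unitary Q)
    {k m : ℕ} (hkm : k ≤ m) (hm : m ≤ n) {C : Set (ExtLit Sg)}
    (hC : ∀ l, Mentions C l → l ∈ language Q a k) :
    stageSum Q a m C = stageSum Q a k C := by
  induction m, hkm using Nat.le_induction with
  | base => rfl
  | succ m hkm ih =>
    rw [← ih (Nat.le_of_succ_le hm), ← one_mul (stageSum Q a m C), ← Set.union_empty C]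
    have := h.stageSum_succ (k := ⟨m, hm⟩) (C := C) (D := ∅) (c := 1)
      (fun l hl => language_mono Q a hkm (hC l hl)) ?_
    · simpa using this
    · intro W hW _
      obtain ⟨X, hX, rfl⟩ := h.exists_full_extension (Nat.le_of_succ_le hm) hW
      rw [← h.sum_weight_eq_one hadm hunit (k := ⟨m, hm⟩) hX]
      refine Finset.sum_congr ?_ fun _ _ => rfl
      ext Y
      simp [HoldsAll]

theorem stageSum_empty (h : CausalOrder Q lvl a) (hadm : Admissible Q) (hunit : Unitary Q) :
    stageSum Q a n ∅ = 1 := by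
  rw [h.stageSum_eq hadm hunit (Nat.zero_le n) le_rfl (by rintro l ⟨e, he, -⟩; exact he.elim)]
  obtain ⟨W, hW, hWu⟩ := h.base
  have hsing : (Set.toFinite {X | X ∈ worlds (stage Q a 0) ∧ HoldsAll X ∅}).toFinset = {W} := by
    ext X
    simp only [Set.Finite.mem_toFinset, Finset.mem_singleton]
    exact ⟨fun hX => hWu X hX.1, fun hX => hX ▸ ⟨hW, fun e he => he.elim⟩⟩
  rw [stageSum, hsing, Finset.sum_singleton]
  simp [stageMeasure]

end CausalOrder

/-- The measure defined by a causally ordered unitary program is defined. -/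
theorem CausallyOrdered.probDefined {Sg : Signature} {Q : Program Sg} (hord : CausallyOrdered Q)
    (hadm : Admissible Q) (hunit : Unitary Q) : ProbDefined Q := by
  obtain ⟨lvl, n, a, h⟩ := hord.exists_causalOrder
  by_contra hno
  have h1 := h.stageSum_empty hadm hunit
  -- If every world had measure zero, the total measure would be 0 instead of 1.
  refine zero_ne_one (α := ℝ) ?_
  rw [← h1, stageSum]
  refine (Finset.sum_eq_zero fun X hX => ?_).symm
  have hX' := ((Set.Finite.mem_toFinset _).1 hX).1
  rw [worlds_stage_last] at hX'
  rw [← h.muHat_eq_stageMeasure]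
  by_contra hne
  exact hno ⟨X, hX', hne⟩

/-! ### Total measures and the weight of a pr-atom -/

/-- The total unnormalized measure of the possible worlds that satisfy `B`. -/
noncomputable def totalMeasure {Sg : Signature} (Q : Program Sg) (B : Set (ExtLit Sg)) : ℝ :=
  ∑ X ∈ (Set.toFinite {X | X ∈ worlds Q ∧ HoldsAll X B}).toFinset, muHat Q X

theorem totalMeasure_empty {Sg : Signature} (Q : Program Sg) :
    totalMeasure Q ∅ = ∑ X ∈ (Set.toFinite (worlds Q)).toFinset, muHat Q X := by
  refine Finset.sum_congr ?_ fun _ _ => rfl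
  ext X
  simp [HoldsAll]

theorem prob_eq_div {Sg : Signature} (Q : Program Sg) (B : Set (ExtLit Sg)) :
    prob Q B = totalMeasure Q B / totalMeasure Q ∅ := by
  rw [totalMeasure_empty, totalMeasure, Finset.sum_div]
  rfl

theorem CausalOrder.totalMeasure_eq {Sg : Signature} {Q : Program Sg} {lvl : AttrTerm Sg → ℕ}
    {n : ℕ} {a : Fin n → AttrTerm Sg} (h : CausalOrder Q lvl a) (B : Set (ExtLit Sg)) :
    totalMeasure Q B = stageSum Q a n B := by
  simp only [totalMeasure, stageSum, worlds_stage_last, h.muHat_eq_stageMeasure]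

/-- The conditional probability of the atom of a pr-atom is the assigned one. -/
theorem CausallyOrdered.totalMeasure_prAtom {Sg : Signature} {Q : Program Sg}
    (hord : CausallyOrdered Q) (hadm : Admissible Q) (hunit : Unitary Q) (hacts : Q.acts = ∅)
    {q : PrAtom Sg} (hq : q ∈ Q.prAtoms) :
    totalMeasure Q (q.body ∪ q.rule.body ∪ {.lit (.pos q.atom)}) =
      q.prob * totalMeasure Q (q.body ∪ q.rule.body) := by
  obtain ⟨lvl, n, a, h⟩ := hord.exists_causalOrder
  obtain ⟨k, hk⟩ : q.rule.attr ∈ Set.range a :=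
    h.range_eq ▸ ⟨q.rule, Q.prAtoms_rule q hq, rfl⟩
  obtain ⟨y, hy⟩ : ∃ y : Val Sg (a k), q.atom = ⟨a k, y⟩ := by
    rw [hk]; exact ⟨q.val, rfl⟩
  have hC : ∀ l, Mentions (q.body ∪ q.rule.body) l → l ∈ language Q a k := by
    rintro l ⟨e, he | he, rfl⟩
    · exact h.prAtom_body_subset hq hk.symm ⟨e, he, rfl⟩
    · exact h.body_subset (Q.prAtoms_rule q hq) hk.symm ⟨e, he, rfl⟩
  have hCy : ∀ l, Mentions (q.body ∪ q.rule.body ∪ {.lit (.pos q.atom)}) l →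
      l ∈ language Q a (k + 1) := by
    rintro l ⟨e, he | rfl, rfl⟩
    · exact language_mono Q a (Nat.le_succ _) (hC _ ⟨e, he, rfl⟩)
    · exact (h.mem_language_iff (j := k) (by rw [hy]; rfl)).2 (Nat.lt_succ_self _)
  rw [h.totalMeasure_eq, h.totalMeasure_eq, h.stageSum_eq hadm hunit (Nat.succ_le_of_lt k.2)
    le_rfl hCy, h.stageSum_eq hadm hunit k.2.le le_rfl hC]
  refine h.stageSum_succ hC fun W hW hWC => ?_
  obtain ⟨X, hX, rfl⟩ := h.exists_full_extension k.2.le hW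
  have hXC : HoldsAll X (q.body ∪ q.rule.body) :=
    (holdsAll_congr (fun l hl => tauLit_mem_project_iff hX hl) hC).1 hWC
  obtain ⟨hB, hK⟩ := holdsAll_union.1 hXC
  -- An intervention would suppress the assigned probability; its absence is guaranteed by the lack
  -- of actions.
  have hi : .pos (.intervene q.rule.attr) ∉ X := by
    rw [intervene_mem_iff hX, hacts]
    simp
  have hassigns := hadm.assigns hX hq hK hB hi
  have hcp := hadm.causalProb_eq hX hassigns
  rw [hy] at hassigns hcp ⊢
  rw [h.sum_weight_of_possible hX (HasPA.possible ⟨q, hassigns⟩), hcp]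

/-! ### Conditioning on observations -/

theorem holdsAll_union_obsFacts {Sg : Signature} {X : Set (TauLit Sg)} {B C : Set (ExtLit Sg)} :
    HoldsAll (X ∪ obsFacts B) C ↔ HoldsAll X C :=
  holdsAll_congr (L := Set.univ) (fun l _ => holds_union_obsFacts l) fun _ _ => trivial

theorem inDynamicRange_union_obsFacts {Sg : Signature} {X : Set (TauLit Sg)}
    {B : Set (ExtLit Sg)} {r : SelectionRule Sg} {y : Sg.Term} :
    InDynamicRange (X ∪ obsFacts B) r y ↔ InDynamicRange X r y :=
  forall₂_congr fun _ _ => exists_congr fun l => and_congr_right fun _ => holds_union_obsFacts l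

/-- Premises, dynamic ranges and pr-atom bodies never refer to observation literals. -/
theorem muHat_observe {Sg : Signature} (Q : Program Sg) (B : Set (ExtLit Sg))
    (X : Set (TauLit Sg)) : muHat (observe Q B) (X ∪ obsFacts B) = muHat Q X := by
  classical
  have hsc : ∀ b, SameCauses Q b (X ∪ obsFacts B) X := fun b =>
    ⟨fun _ _ _ => holdsAll_union_obsFacts, fun _ _ _ _ => inDynamicRange_union_obsFacts,
      fun _ _ _ => holdsAll_union_obsFacts⟩
  have hi : ∀ b, .pos (.intervene b) ∈ X ∪ obsFacts B ↔ .pos (.intervene b) ∈ X := by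
    intro b
    constructor
    · rintro (h | ⟨e, -, he⟩)
      · exact h
      · simp at he
    · exact Or.inl
  have h1 : muHat (observe Q B) (X ∪ obsFacts B) = muHat Q (X ∪ obsFacts B) := rfl
  rw [h1, muHat, muHat]
  refine Finset.prod_congr ?_ fun ⟨b, y⟩ _ => (hsc b).causalProb_eq (hi b) y
  ext ⟨b, y⟩
  simp only [Set.Finite.mem_toFinset, Set.mem_ofPred_eq, holds_union_obsFacts,
    (hsc b).possible_iff]

theorem worlds_iff_facts_empty {Sg : Signature} {Q : Program Sg} {X : Set (TauLit Sg)} :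
    X ∈ worlds Q ↔ IsAnswerSet (tau Q ∪ fact '' ∅) X := by
  rw [Set.image_empty, Set.union_empty]
  rfl

theorem mem_worlds_observe {Sg : Signature} {Q : Program Sg} {B : Set (ExtLit Sg)}
    {Y : Set (TauLit Sg)} :
    Y ∈ worlds (observe Q B) ↔ ∃ X ∈ worlds Q, HoldsAll X B ∧ X ∪ obsFacts B = Y := by
  rw [worlds_iff_facts_empty]
  constructor
  · intro hY
    obtain ⟨X, hX, hB, rfl⟩ := exists_of_isAnswerSet_observe hY
    exact ⟨X, worlds_iff_facts_empty.2 hX, hB, rfl⟩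
  · rintro ⟨X, hX, hB, rfl⟩
    exact isAnswerSet_observe (worlds_iff_facts_empty.1 hX) (by simp) hB

/-- Adjoining the observation facts is a measure-preserving bijection from the worlds satisfying `B`
onto the worlds of the observed program. -/
theorem totalMeasure_observe {Sg : Signature} (Q : Program Sg) (B C : Set (ExtLit Sg)) :
    totalMeasure (observe Q B) C = totalMeasure Q (B ∪ C) := by
  refine (Finset.sum_bij (fun X _ => X ∪ obsFacts B) ?_ ?_ ?_ ?_).symm
  · intro X hX
    obtain ⟨hX, hXB⟩ := (Set.Finite.mem_toFinset _).1 hX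
    obtain ⟨hB, hC⟩ := holdsAll_union.1 hXB
    rw [Set.Finite.mem_toFinset]
    exact ⟨mem_worlds_observe.2 ⟨X, hX, hB, rfl⟩, holdsAll_union_obsFacts.2 hC⟩
  · intro X hX Y hY heq
    exact union_obsFacts_injective
      (worlds_iff_facts_empty.1 ((Set.Finite.mem_toFinset _).1 hX).1)
      (worlds_iff_facts_empty.1 ((Set.Finite.mem_toFinset _).1 hY).1) heq
  · intro Y hY
    obtain ⟨hY, hC⟩ := (Set.Finite.mem_toFinset _).1 hY
    obtain ⟨X, hX, hB, rfl⟩ := mem_worlds_observe.1 hY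
    exact ⟨X, (Set.Finite.mem_toFinset _).2
      ⟨hX, holdsAll_union.2 ⟨hB, holdsAll_union_obsFacts.1 hC⟩⟩, rfl⟩
  · exact fun X _ => (muHat_observe Q B X).symm

theorem observe_observe {Sg : Signature} (Q : Program Sg) (B C : Set (ExtLit Sg)) :
    observe (observe Q B) C = observe Q (B ∪ C) := by
  simp only [observe, Set.union_assoc]

theorem probDefined_of_totalMeasure {Sg : Signature} {Q : Program Sg} {B : Set (ExtLit Sg)}
    (h : totalMeasure Q B ≠ 0) : ProbDefined Q := by
  obtain ⟨X, hX, hne⟩ := Finset.exists_ne_zero_of_sum_ne_zero h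
  exact ⟨X, ((Set.Finite.mem_toFinset _).1 hX).1, hne⟩

end PLog

/-! ### Coherency -/

theorem mainTheorem1 (Sg : PLog.Signature) (Q : PLog.Program Sg)
    (hadm : PLog.Admissible Q) (hord : PLog.CausallyOrdered Q) (hunit : PLog.Unitary Q)
    (hadm' : PLog.Admissible (PLog.withoutObsActs Q))
    (hord' : PLog.CausallyOrdered (PLog.withoutObsActs Q))
    (hunit' : PLog.Unitary (PLog.withoutObsActs Q)) :
    PLog.Coherent Q := by
  have hdef := hord.probDefined hadm hunit
  refine ⟨hdef.imp fun _ h => h.1, hdef, fun q hq hne => ?_⟩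
  rw [PLog.prob_eq_div] at hne
  have hne' := (div_ne_zero_iff.1 hne).1
  rw [PLog.observe_observe]
  -- Numerator and denominator of the conditional probability both become total measures of the
  -- program without observations and actions, so its normalization drops out.
  have hobs := PLog.totalMeasure_observe (PLog.withoutObsActs Q) (q.body ∪ q.rule.body)
  have h0 := hobs ∅
  rw [Set.union_empty] at h0
  refine ⟨PLog.probDefined_of_totalMeasure (h0 ▸ hne'), ?_⟩
  rw [PLog.prob_eq_div, h0, hobs, hord'.totalMeasure_prAtom hadm' hunit' rfl hq,
    mul_div_cancel_right₀ _ hne']
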